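/- Let $d,k\ge 1$ be integers and let $\Delta_d=\{h\in\mathbb{R}^d : 0<h_1\le\dots\le h_d\le 1\}$. For $h\in\Delta_d$ let $\mathcal{P}_h$ be the real linear span of the functions $\varphi_i(t)=t^{m_i}e^{-h_it}$, $i=1,\dots,d$, where $m_i$ is the number of indices $j<i$ with $h_j=h_i$ (so an exponent $a$ of multiplicity $m$ contributes $e^{-at},te^{-at},\dots,t^{m-1}e^{-at}$). Write $\|f\|=\sup_{t\ge 0}|f(t)|$ and let $$M_k(h)=\max\{\,\|p^{(k)}\| : p\in\mathcal{P}_h,\ \|p\|\le 1\,\},$$ the sharp constant in the Markov–Bernstein inequality $\|p^{(k)}\|\le M_k(h)\,\|p\|$, $p\in\mathcal{P}_h$. This maximum exists and is finite for every $h\in\Delta_d$, and the function $h\mapsto M_k(h)$ attains its maximum on $\Delta_d$ at the unique point $h=(1,\dots,1)$. -/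

import Mathlib

open scoped ENNReal

/-- The simplex `Δ_d = {0 < h₁ ≤ ⋯ ≤ h_d ≤ 1}` of ordered exponent vectors. -/
def expSimplex (d : ℕ) : Set (Fin d → ℝ) :=
  {h | Monotone h ∧ ∀ i, 0 < h i ∧ h i ≤ 1}

/-- The number of earlier entries of `h` that coincide with `h i`. -/
noncomputable def priorMult {d : ℕ} (h : Fin d → ℝ) (i : Fin d) : ℕ :=
  Set.ncard {j : Fin d | j < i ∧ h j = h i}

/-- The `i`-th function `t ↦ t ^ m * exp (-h_i t)` of the system of exponents of `h`, where `m` is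
the number of earlier entries equal to `h_i`; so an exponent `a` of multiplicity `m` contributes
`exp (-a t), t exp (-a t), …, t ^ (m - 1) exp (-a t)`. -/
noncomputable def expSystem {d : ℕ} (h : Fin d → ℝ) (i : Fin d) : ℝ → ℝ :=
  fun t => t ^ priorMult h i * Real.exp (-(h i) * t)

/-- The space `𝒫_h` of exponential polynomials, the real span of the system of exponents of `h`.
Its elements are regarded as (real-analytic) functions on all of `ℝ`, which gives meaning to
derivatives at the endpoint `0` of the half-line. -/
noncomputable def expPoly {d : ℕ} (h : Fin d → ℝ) : Submodule ℝ (ℝ → ℝ) :=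
  Submodule.span ℝ (Set.range (expSystem h))

/-- The supremum norm on the half-line `ℝ₊ = [0, ∞)`, as an extended nonnegative real. -/
noncomputable def halfLineNorm (f : ℝ → ℝ) : ℝ≥0∞ :=
  ⨆ t ∈ Set.Ici (0 : ℝ), ‖f t‖ₑ

/-- The values `‖p⁽ᵏ⁾‖` for `p` in the unit ball of `𝒫_h`, norms being taken on `ℝ₊`. -/
def derivNormValues {d : ℕ} (k : ℕ) (h : Fin d → ℝ) : Set ℝ≥0∞ :=
  {c | ∃ p ∈ expPoly h, halfLineNorm p ≤ 1 ∧ halfLineNorm (iteratedDeriv k p) = c}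

/-- The sharp Markov–Bernstein constant `M_k(h)`: the optimal value of
`‖p⁽ᵏ⁾‖ → max` subject to `p ∈ 𝒫_h`, `‖p‖ ≤ 1`. -/
noncomputable def markovConst {d : ℕ} (k : ℕ) (h : Fin d → ℝ) : ℝ≥0∞ :=
  sSup (derivNormValues k h)

open Polynomial Filter Topology

/-! The space `𝒫_h` is the kernel of `∏ (D + h_i)`, so it is finite-dimensional, stable under
differentiation and translation, and all its elements decay at infinity. Moving forward along the
half-line preserves the unit ball, so `M_k(h)` is the maximum of the linear functional `p ↦
p⁽ᵏ⁾(0)`, attained by some `T`. Everything reduces to showing that this value strictly increases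
when one exponent `a` is raised to `b > a`; raising the exponents to `1` one by one then gives both
maximality and uniqueness.

Two facts carry the comparison. First, `T` equioscillates: it equals `±1` with alternating signs at
as many points as there are exponents (`IsExtremal.alternates`). By duality the functional is a
positive combination of signed evaluations at contact points; with fewer alternations, some `r`
would copy the signs of `T` at those points while `r⁽ᵏ⁾(0) = 0`.

Second, `D + c` obeys Rolle's theorem with respect to sign changes, because `(D + c) f = e^{-ct}
(e^{ct} f)'`. Let `n` be the number of unchanged exponents, and suppose `p` in the ball of the
lowered space has `p⁽ᵏ⁾(0) = T⁽ᵏ⁾(0)`. A slight perturbation of `T - p` alternates at `n + 1`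
points. Decay at infinity keeps all these alternations under `Dᵏ`, and the vanishing of the `k`-th
derivative at `0` keeps them under `D + a`. The remaining `n` factors then reduce the function to a
multiple of `e^{-bt}` of forced sign. Since `a - b < 0`, this contradicts the sign obtained from `T`
itself (`deriv_ne_of_exponent_lt`). -/

/-! ### Differential operators with real characteristic roots and their kernels. -/

/-- The space of smooth functions on the real line. -/
def smoothFun : Submodule ℝ (ℝ → ℝ) where
  carrier := {f | ContDiff ℝ (⊤ : ℕ∞) f}
  add_mem' := by
    intro f g (hf : ContDiff ℝ (⊤ : ℕ∞) f) (hg : ContDiff ℝ (⊤ : ℕ∞) g)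
    exact hf.add hg
  zero_mem' := (contDiff_const : ContDiff ℝ (⊤ : ℕ∞) fun _ : ℝ => (0 : ℝ))
  smul_mem' := by
    intro c f (hf : ContDiff ℝ (⊤ : ℕ∞) f)
    exact hf.const_smul c

theorem contDiff_smoothFun (f : smoothFun) : ContDiff ℝ (⊤ : ℕ∞) f.1 := f.2

theorem differentiable_smoothFun (f : smoothFun) : Differentiable ℝ f.1 :=
  (contDiff_infty_iff_deriv.1 f.2).1

theorem continuous_smoothFun (f : smoothFun) : Continuous f.1 :=
  (differentiable_smoothFun f).continuous

/-- Differentiation of smooth functions. -/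
noncomputable def smoothDeriv : Module.End ℝ smoothFun where
  toFun f := ⟨deriv f.1, (contDiff_infty_iff_deriv.1 f.2).2⟩
  map_add' f g := by
    ext t
    exact deriv_add (differentiable_smoothFun f t) (differentiable_smoothFun g t)
  map_smul' c f := by
    ext t
    exact deriv_const_mul c (differentiable_smoothFun f t)

theorem smoothDeriv_coe (f : smoothFun) : (smoothDeriv f).1 = deriv f.1 := rfl

theorem hasDerivAt_smoothFun (f : smoothFun) (t : ℝ) :
    HasDerivAt f.1 ((smoothDeriv f).1 t) t :=
  (differentiable_smoothFun f t).hasDerivAt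

theorem smoothDeriv_pow_coe (k : ℕ) (f : smoothFun) :
    ((smoothDeriv ^ k) f).1 = iteratedDeriv k f.1 := by
  induction k generalizing f with
  | zero => simp
  | succ k ih => rw [pow_succ, Module.End.mul_apply, ih, iteratedDeriv_succ', smoothDeriv_coe]

/-- The operator `∏ (D + c)`, the product being over the exponents `c` in `s`. -/
noncomputable def expOp (s : Multiset ℝ) : Module.End ℝ smoothFun :=
  aeval smoothDeriv (s.map fun c => X + C c).prod

/-- The space of solutions of `∏ (D + c) f = 0`. -/
noncomputable def expSol (s : Multiset ℝ) : Submodule ℝ smoothFun :=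
  LinearMap.ker (expOp s)

theorem expOp_zero_apply (f : smoothFun) : expOp 0 f = f := by
  simp [expOp]

theorem expOp_singleton_apply (c : ℝ) (f : smoothFun) :
    expOp {c} f = smoothDeriv f + c • f := by
  simp [expOp, Algebra.algebraMap_eq_smul_one]

theorem expOp_add_apply (s u : Multiset ℝ) (f : smoothFun) :
    expOp (s + u) f = expOp s (expOp u f) := by
  simp [expOp]

theorem expOp_cons_apply (c : ℝ) (s : Multiset ℝ) (f : smoothFun) :
    expOp (c ::ₘ s) f = expOp {c} (expOp s f) := by
  rw [← Multiset.singleton_add, expOp_add_apply]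

theorem expOp_cons_apply' (c : ℝ) (s : Multiset ℝ) (f : smoothFun) :
    expOp (c ::ₘ s) f = expOp s (expOp {c} f) := by
  rw [← Multiset.singleton_add, add_comm, expOp_add_apply]

theorem expOp_singleton_coe (c : ℝ) (f : smoothFun) (t : ℝ) :
    (expOp {c} f).1 t = (smoothDeriv f).1 t + c * f.1 t := by
  rw [expOp_singleton_apply]; rfl

theorem expOp_smoothDeriv_pow (s : Multiset ℝ) (k : ℕ) (f : smoothFun) :
    expOp s ((smoothDeriv ^ k) f) = (smoothDeriv ^ k) (expOp s f) := by
  have h : smoothDeriv ^ k = aeval smoothDeriv (X ^ k : ℝ[X]) := by simp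
  rw [h, expOp, ← Module.End.mul_apply, ← Module.End.mul_apply, ← map_mul, ← map_mul, mul_comm]

theorem mem_expSol {s : Multiset ℝ} {f : smoothFun} : f ∈ expSol s ↔ expOp s f = 0 :=
  LinearMap.mem_ker

theorem expSol_mono {s u : Multiset ℝ} (h : s ≤ u) : expSol s ≤ expSol u := by
  obtain ⟨v, rfl⟩ := Multiset.le_iff_exists_add.1 h
  intro f hf
  rw [mem_expSol] at hf ⊢
  rw [add_comm, expOp_add_apply, hf, map_zero]

theorem smoothDeriv_pow_mem_expSol {s : Multiset ℝ} {f : smoothFun} (hf : f ∈ expSol s) (k : ℕ) :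
    (smoothDeriv ^ k) f ∈ expSol s := by
  rw [mem_expSol] at hf ⊢
  rw [expOp_smoothDeriv_pow, hf, map_zero]

theorem smoothDeriv_mem_expSol {s : Multiset ℝ} {f : smoothFun} (hf : f ∈ expSol s) :
    smoothDeriv f ∈ expSol s := by
  simpa using smoothDeriv_pow_mem_expSol hf 1

theorem expOp_singleton_mem {c : ℝ} {s : Multiset ℝ} {f : smoothFun} (hf : f ∈ expSol (c ::ₘ s)) :
    expOp {c} f ∈ expSol s := by
  rw [mem_expSol] at hf ⊢
  rw [← expOp_cons_apply', hf]

/-- Translation of smooth functions. -/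
def smoothShift (a : ℝ) : Module.End ℝ smoothFun where
  toFun f := ⟨fun t => f.1 (t + a), (contDiff_smoothFun f).comp (contDiff_id.add contDiff_const)⟩
  map_add' _ _ := rfl
  map_smul' _ _ := rfl

theorem smoothDeriv_shift (a : ℝ) (f : smoothFun) :
    smoothDeriv (smoothShift a f) = smoothShift a (smoothDeriv f) := by
  ext t
  exact deriv_comp_add_const f.1 a t

theorem smoothDeriv_pow_shift (a : ℝ) (k : ℕ) (f : smoothFun) :
    (smoothDeriv ^ k) (smoothShift a f) = smoothShift a ((smoothDeriv ^ k) f) := by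
  induction k generalizing f with
  | zero => simp
  | succ k ih => simp only [pow_succ, Module.End.mul_apply, smoothDeriv_shift, ih]

theorem expOp_shift (s : Multiset ℝ) (a : ℝ) (f : smoothFun) :
    expOp s (smoothShift a f) = smoothShift a (expOp s f) := by
  induction s using Multiset.induction_on generalizing f with
  | empty => simp [expOp_zero_apply]
  | cons c s ih =>
    rw [expOp_cons_apply, expOp_cons_apply, ih, expOp_singleton_apply, expOp_singleton_apply,
      smoothDeriv_shift, map_add, map_smul]

theorem smoothShift_mem_expSol {s : Multiset ℝ} {f : smoothFun} (hf : f ∈ expSol s) (a : ℝ) :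
    smoothShift a f ∈ expSol s := by
  rw [mem_expSol] at hf ⊢
  rw [expOp_shift, hf, map_zero]

/-! ### Exponential polynomials as solutions; dimension and decay. -/

/-- The exponential polynomial `q(t) e^{-at}`. -/
noncomputable def polyExp (a : ℝ) (q : ℝ[X]) : smoothFun :=
  ⟨fun t => q.eval t * Real.exp (-a * t), by
    have h1 : ContDiff ℝ (⊤ : ℕ∞) fun t : ℝ => aeval t q := q.contDiff_aeval _
    have h2 : ContDiff ℝ (⊤ : ℕ∞) fun t : ℝ => Real.exp (-a * t) := by fun_prop
    exact h1.mul h2⟩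

theorem polyExp_coe (a : ℝ) (q : ℝ[X]) (t : ℝ) :
    (polyExp a q).1 t = q.eval t * Real.exp (-a * t) := rfl

theorem polyExp_C (a K : ℝ) : polyExp a (C K) = K • polyExp a 1 := by
  ext t
  simp [polyExp]

theorem smoothDeriv_polyExp (a : ℝ) (q : ℝ[X]) :
    smoothDeriv (polyExp a q) = polyExp a (derivative q - C a * q) := by
  ext t
  have h1 : HasDerivAt (fun t => Real.exp (-a * t)) (Real.exp (-a * t) * (-a * 1)) t :=
    ((hasDerivAt_id t).const_mul (-a)).exp
  have h2 := (q.hasDerivAt t).mul h1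
  rw [smoothDeriv_coe]
  refine (h2.deriv.trans ?_)
  simp [polyExp]
  ring

theorem expOp_singleton_polyExp (a c : ℝ) (q : ℝ[X]) :
    expOp {c} (polyExp a q) = polyExp a (derivative q + C (c - a) * q) := by
  rw [expOp_singleton_apply, smoothDeriv_polyExp]
  ext t
  simp [polyExp]
  ring

theorem smoothDeriv_pow_polyExp_one (a : ℝ) (k : ℕ) :
    (smoothDeriv ^ k) (polyExp a 1) = (-a) ^ k • polyExp a 1 := by
  induction k with
  | zero => simp
  | succ k ih =>
    rw [pow_succ, Module.End.mul_apply, smoothDeriv_polyExp,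
      show derivative (1 : ℝ[X]) - C a * 1 = C (-a) by simp, polyExp_C, map_smul, ih, smul_smul,
      pow_succ, mul_comm]

theorem polyExp_one_ne_zero (a : ℝ) : polyExp a 1 ≠ 0 := by
  intro h
  have := congrFun (congrArg Subtype.val h) 0
  simp [polyExp] at this

/-- The factor `D + c` lowers the degree of `q` by one if `c = a` and preserves it otherwise, so
after all factors exactly a nonzero constant remains. -/
theorem expOp_polyExp (a : ℝ) (s : Multiset ℝ) (q : ℝ[X]) (hq : q.degree = s.count a) :
    ∃ K : ℝ, K ≠ 0 ∧ expOp s (polyExp a q) = K • polyExp a 1 := by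
  induction s using Multiset.induction_on generalizing q with
  | empty =>
    have h0 : q.degree = 0 := by simpa using hq
    refine ⟨q.coeff 0, ?_, by rw [expOp_zero_apply, ← polyExp_C, ← eq_C_of_degree_eq_zero h0]⟩
    intro h
    rw [eq_C_of_degree_eq_zero h0, h] at h0
    simp at h0
  | cons c s ih =>
    rw [expOp_cons_apply', expOp_singleton_polyExp]
    apply ih
    by_cases hc : a = c
    · subst hc
      rw [Multiset.count_cons_self] at hq
      have hn := natDegree_eq_of_degree_eq_some hq
      simp [degree_derivative (p := q) (by omega), hn]
    · rw [Multiset.count_cons_of_ne hc] at hq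
      have h1 : (C (c - a) * q).degree = q.degree :=
        degree_C_mul (sub_ne_zero.2 (Ne.symm hc))
      have hq0 : q ≠ 0 := by
        rintro rfl
        simp at hq
      rw [degree_add_eq_right_of_degree_lt, h1, hq]
      rw [h1]
      exact degree_derivative_lt hq0

theorem eq_smul_polyExp_one {c : ℝ} {f : smoothFun} (hf : expOp {c} f = 0) :
    f = f.1 0 • polyExp c 1 := by
  have hd : ∀ t, HasDerivAt (fun t => f.1 t * Real.exp (c * t)) 0 t := by
    intro t
    have h1 : HasDerivAt (fun t => Real.exp (c * t)) (Real.exp (c * t) * (c * 1)) t :=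
      ((hasDerivAt_id t).const_mul c).exp
    have h2 := (hasDerivAt_smoothFun f t).mul h1
    have h3 : (expOp {c} f).1 t = 0 := by rw [hf]; rfl
    rw [expOp_singleton_coe] at h3
    refine h2.congr_deriv ?_
    linear_combination Real.exp (c * t) * h3
  ext t
  have := is_const_of_deriv_eq_zero (fun t => (hd t).differentiableAt) (fun t => (hd t).deriv) t 0
  simp only [mul_zero, Real.exp_zero, mul_one] at this
  change f.1 t = f.1 0 * ((1 : ℝ[X]).eval t * Real.exp (-c * t))
  rw [← this, eval_one, one_mul, mul_assoc, ← Real.exp_add]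
  simp

theorem polyExp_X_pow_mem (c : ℝ) (s : Multiset ℝ) :
    polyExp c (X ^ s.count c) ∈ expSol (c ::ₘ s) := by
  obtain ⟨K, -, hK⟩ := expOp_polyExp c s (X ^ s.count c) (by simp)
  rw [mem_expSol, expOp_cons_apply, hK, map_smul, expOp_singleton_polyExp]
  ext t
  simp [polyExp]

theorem polyExp_X_pow_notMem (c : ℝ) (s : Multiset ℝ) :
    polyExp c (X ^ s.count c) ∉ expSol s := by
  obtain ⟨K, hK0, hK⟩ := expOp_polyExp c s (X ^ s.count c) (by simp)
  rw [mem_expSol, hK]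
  exact smul_ne_zero hK0 (polyExp_one_ne_zero c)

/-- On this kernel `∏ (D + x)` over `s` takes values in the multiples of `e^{-ct}`; the new
generator is sent to a nonzero such multiple, so subtracting a multiple of it lands in the smaller
kernel. -/
theorem expSol_cons (c : ℝ) (s : Multiset ℝ) :
    expSol (c ::ₘ s) = Submodule.span ℝ {polyExp c (X ^ s.count c)} ⊔ expSol s := by
  apply le_antisymm
  · intro f hf
    obtain ⟨K, hK0, hK⟩ := expOp_polyExp c s (X ^ s.count c) (by simp)
    rw [mem_expSol, expOp_cons_apply] at hf
    have hc := eq_smul_polyExp_one hf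
    refine Submodule.mem_sup.2 ⟨((expOp s f).1 0 / K) • polyExp c (X ^ s.count c),
      Submodule.smul_mem _ _ (Submodule.mem_span_singleton_self _),
      f - ((expOp s f).1 0 / K) • polyExp c (X ^ s.count c), ?_, by abel⟩
    rw [mem_expSol, map_sub, map_smul, hK, smul_smul, div_mul_cancel₀ _ hK0, ← hc, sub_self]
  · refine sup_le ?_ (expSol_mono (Multiset.le_cons_self s c))
    rw [Submodule.span_singleton_le_iff_mem]
    exact polyExp_X_pow_mem c s

theorem expSol_zero : expSol 0 = ⊥ := by
  ext f
  rw [mem_expSol, expOp_zero_apply, Submodule.mem_bot]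

theorem expSol_finite_and_card_le (s : Multiset ℝ) :
    FiniteDimensional ℝ (expSol s) ∧ s.card ≤ Module.finrank ℝ (expSol s) := by
  induction s using Multiset.induction_on with
  | empty =>
    rw [expSol_zero]
    exact ⟨inferInstance, by simp⟩
  | cons c s ih =>
    obtain ⟨h1, h2⟩ := ih
    have h3 : FiniteDimensional ℝ (expSol (c ::ₘ s)) := by
      rw [expSol_cons]
      infer_instance
    refine ⟨h3, ?_⟩
    have hlt : expSol s < expSol (c ::ₘ s) :=
      lt_of_le_of_ne (expSol_mono (Multiset.le_cons_self s c)) fun h =>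
        polyExp_X_pow_notMem c s (h ▸ polyExp_X_pow_mem c s)
    have := Submodule.finrank_lt_finrank_of_lt hlt
    rw [Multiset.card_cons]
    omega

instance expSol_finiteDimensional (s : Multiset ℝ) : FiniteDimensional ℝ (expSol s) :=
  (expSol_finite_and_card_le s).1

theorem card_le_finrank_expSol (s : Multiset ℝ) : s.card ≤ Module.finrank ℝ (expSol s) :=
  (expSol_finite_and_card_le s).2

theorem tendsto_polyExp_X_pow {c : ℝ} (hc : 0 < c) (m : ℕ) :
    Tendsto (polyExp c (X ^ m)).1 atTop (𝓝 0) := by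
  have := Real.tendsto_pow_mul_exp_neg_atTop_nhds_zero m
  have h2 := (this.comp (tendsto_id.const_mul_atTop hc)).const_mul ((c ^ m)⁻¹)
  rw [mul_zero] at h2
  refine h2.congr fun t => ?_
  simp only [Function.comp, id, polyExp_coe, eval_pow, eval_X, mul_pow]
  field_simp

theorem tendsto_of_mem_expSol {s : Multiset ℝ} (hs : ∀ c ∈ s, 0 < c) {f : smoothFun}
    (hf : f ∈ expSol s) : Tendsto f.1 atTop (𝓝 0) := by
  induction s using Multiset.induction_on generalizing f with
  | empty =>
    rw [expSol_zero, Submodule.mem_bot] at hf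
    subst hf
    exact tendsto_const_nhds
  | cons c s ih =>
    rw [expSol_cons] at hf
    obtain ⟨g, hg, u, hu, rfl⟩ := Submodule.mem_sup.1 hf
    obtain ⟨K, rfl⟩ := Submodule.mem_span_singleton.1 hg
    have h1 := (tendsto_polyExp_X_pow (hs c (Multiset.mem_cons_self c s)) (s.count c)).const_mul K
    have h2 := ih (fun x hx => hs x (Multiset.mem_cons_of_mem hx)) hu
    have h3 := h1.add h2
    rw [mul_zero, add_zero] at h3
    exact h3

theorem expSystem_castSucc {d : ℕ} (h : Fin (d + 1) → ℝ) (i : Fin d) :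
    expSystem h i.castSucc = expSystem (h ∘ Fin.castSucc) i := by
  have : priorMult h i.castSucc = priorMult (h ∘ Fin.castSucc) i := by
    unfold priorMult
    rw [← Set.ncard_image_of_injective _ (Fin.castSucc_injective d)]
    congr 1
    ext j
    constructor
    · rintro ⟨hj, he⟩
      refine ⟨⟨j, lt_trans (Fin.lt_def.1 hj) i.2⟩, ⟨?_, he⟩, rfl⟩
      exact Fin.lt_def.2 (Fin.lt_def.1 hj)
    · rintro ⟨j', ⟨hj, he⟩, rfl⟩
      exact ⟨by simpa using hj, he⟩
  unfold expSystem
  rw [this]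
  rfl

theorem priorMult_last {d : ℕ} (h : Fin (d + 1) → ℝ) :
    priorMult h (Fin.last d) =
      (Finset.univ.val.map (h ∘ Fin.castSucc)).count (h (Fin.last d)) := by
  unfold priorMult
  rw [Multiset.count_map, ← Finset.filter_val, Finset.card_val,
    ← Set.ncard_coe_finset, ← Set.ncard_image_of_injective _ (Fin.castSucc_injective d)]
  congr 1
  ext j
  constructor
  · rintro ⟨hj, he⟩
    exact ⟨⟨j, Fin.lt_def.1 hj⟩, by simpa using he.symm, rfl⟩
  · rintro ⟨j', hj, rfl⟩
    exact ⟨Fin.castSucc_lt_last j', by simpa using (by simpa using hj : _ = _).symm⟩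

theorem univ_map_succ {d : ℕ} (h : Fin (d + 1) → ℝ) :
    Finset.univ.val.map h =
      h (Fin.last d) ::ₘ Finset.univ.val.map (h ∘ Fin.castSucc) := by
  rw [Fin.univ_castSuccEmb]
  simp [Function.comp_def]

/-- Adding the last exponent adds one generator on each side, and `priorMult` at the last index is
the multiplicity used in `expSol_cons`. -/
theorem expPoly_eq_map {d : ℕ} (h : Fin d → ℝ) :
    expPoly h = (expSol (Finset.univ.val.map h)).map smoothFun.subtype := by
  induction d with
  | zero =>
    have : (Finset.univ : Finset (Fin 0)).val.map h = 0 := by simp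
    rw [this, expSol_zero, Submodule.map_bot, expPoly, Set.range_eq_empty, Submodule.span_empty]
  | succ d ih =>
    rw [univ_map_succ, expSol_cons, Submodule.map_sup, ← ih, Submodule.map_span,
      Set.image_singleton, expPoly, expPoly, ← Submodule.span_union]
    congr 1
    ext f
    simp only [Set.mem_range, Set.singleton_union, Set.mem_insert_iff, Fin.exists_fin_succ',
      expSystem_castSucc]
    rw [or_comm]
    have : expSystem h (Fin.last d) = smoothFun.subtype (polyExp (h (Fin.last d))
        (X ^ (Finset.univ.val.map (h ∘ Fin.castSucc)).count (h (Fin.last d)))) := by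
      funext t
      simp [expSystem, polyExp, priorMult_last]
    rw [this]
    exact or_congr_left eq_comm

/-! ### Rolle-type arguments and zero counting. -/

theorem expOp_singleton_zero (f : smoothFun) : expOp {0} f = smoothDeriv f := by
  rw [expOp_singleton_apply, zero_smul, add_zero]

theorem hasDerivAt_exp_mul (f : smoothFun) (c t : ℝ) :
    HasDerivAt (fun t => Real.exp (c * t) * f.1 t) (Real.exp (c * t) * (expOp {c} f).1 t) t := by
  have h1 : HasDerivAt (fun t => Real.exp (c * t)) (Real.exp (c * t) * (c * 1)) t :=
    ((hasDerivAt_id t).const_mul c).exp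
  refine (h1.mul (hasDerivAt_smoothFun f t)).congr_deriv ?_
  rw [expOp_singleton_coe]
  ring

theorem exists_pos_expOp_of_lt (f : smoothFun) (c s : ℝ) {x y : ℝ} (hxy : x < y)
    (h : s * (Real.exp (c * x) * f.1 x) < s * (Real.exp (c * y) * f.1 y)) :
    ∃ ξ, x < ξ ∧ ξ < y ∧ 0 < s * (expOp {c} f).1 ξ := by
  have hd := fun t => (hasDerivAt_exp_mul f c t).const_mul s
  obtain ⟨ξ, hξ, he⟩ := exists_hasDerivAt_eq_slope _ _ hxy
    (fun t _ => (hd t).continuousAt.continuousWithinAt) (fun t _ => hd t)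
  refine ⟨ξ, hξ.1, hξ.2, ?_⟩
  have h1 : 0 < s * (Real.exp (c * ξ) * (expOp {c} f).1 ξ) := by
    rw [he]
    exact div_pos (sub_pos.2 h) (sub_pos.2 hxy)
  rw [mul_left_comm] at h1
  exact pos_of_mul_pos_right h1 (Real.exp_pos _).le

theorem exists_neg_deriv_of_tendsto {f : smoothFun} (hf : Tendsto f.1 atTop (𝓝 0)) (s : ℝ) {x : ℝ}
    (h : 0 < s * f.1 x) : ∃ ξ, x < ξ ∧ 0 < -s * (smoothDeriv f).1 ξ := by
  have h1 : Tendsto (fun t => s * f.1 t) atTop (𝓝 0) := by simpa using hf.const_mul s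
  obtain ⟨y, hy, hxy⟩ := ((h1.eventually_lt_const h).and (eventually_gt_atTop x)).exists
  obtain ⟨ξ, h2, -, h3⟩ := exists_pos_expOp_of_lt f 0 (-s) hxy (by simpa using hy)
  exact ⟨ξ, h2, by rwa [expOp_singleton_zero] at h3⟩

theorem exists_expOp_eq_zero (f : smoothFun) (c : ℝ) {x y : ℝ} (hxy : x < y)
    (hx : f.1 x = 0) (hy : f.1 y = 0) : ∃ ξ, x < ξ ∧ ξ < y ∧ (expOp {c} f).1 ξ = 0 := by
  have hd := fun t => hasDerivAt_exp_mul f c t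
  obtain ⟨ξ, hξ, he⟩ := exists_hasDerivAt_eq_zero hxy
    (fun t _ => (hd t).continuousAt.continuousWithinAt) (by rw [hx, hy]; simp) (fun t _ => hd t)
  exact ⟨ξ, hξ.1, hξ.2, by simpa using he⟩

/-- Infinity plays the role of a second zero in Rolle's theorem, so differentiating a decaying
function loses no zeros. -/
theorem exists_deriv_eq_zero_of_tendsto {f : smoothFun} (hf : Tendsto f.1 atTop (𝓝 0)) {x : ℝ}
    (hx : f.1 x = 0) : ∃ ξ, x < ξ ∧ (smoothDeriv f).1 ξ = 0 := by
  by_cases h0 : ∃ y, x < y ∧ f.1 y ≠ 0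
  · obtain ⟨y, hxy, hy⟩ := h0
    have hp : 0 < f.1 y * f.1 y := mul_self_pos.2 hy
    obtain ⟨ξ, h1, h2, h3⟩ := exists_pos_expOp_of_lt f 0 (f.1 y) hxy (by simpa [hx] using hp)
    obtain ⟨ζ, h4, h5⟩ := exists_neg_deriv_of_tendsto hf (f.1 y) hp
    rw [expOp_singleton_zero] at h3
    have hc : ContinuousOn (fun t => f.1 y * (smoothDeriv f).1 t) (Set.Icc ξ ζ) :=
      ((continuous_smoothFun _).const_mul _).continuousOn
    obtain ⟨η, hη, he⟩ := intermediate_value_Icc' (h2.trans h4).le hc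
      (show (0 : ℝ) ∈ _ from ⟨by linarith, h3.le⟩)
    exact ⟨η, h1.trans_le hη.1, (mul_eq_zero.1 he).resolve_left hy⟩
  · push Not at h0
    refine ⟨x + 1, by linarith, ?_⟩
    have : f.1 =ᶠ[𝓝 (x + 1)] fun _ => 0 := by
      filter_upwards [lt_mem_nhds (show x < x + 1 by linarith)] with t ht using h0 t ht
    rw [smoothDeriv_coe, this.deriv_eq, deriv_const]

theorem card_image_of_interlacing {Z : Finset ℝ} {ξ : ℝ → ℝ} (h1 : ∀ z ∈ Z, z < ξ z)
    (h2 : ∀ z ∈ Z, ∀ y ∈ Z, z < y → ξ z < y) :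
    (Z.image ξ).card = Z.card ∧ Disjoint (Z.image ξ) Z := by
  have hlt : ∀ z ∈ Z, ∀ y ∈ Z, z < y → ξ z < ξ y := fun z hz y hy h =>
    (h2 z hz y hy h).trans (h1 y hy)
  refine ⟨Finset.card_image_of_injOn fun z hz y hy h => ?_, ?_⟩
  · rcases lt_trichotomy z y with hzy | hzy | hzy
    · exact absurd h (hlt z hz y hy hzy).ne
    · exact hzy
    · exact absurd h (hlt y hy z hz hzy).ne'
  · rw [Finset.disjoint_left]
    intro y hy hyZ
    obtain ⟨z, hz, rfl⟩ := Finset.mem_image.1 hy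
    exact lt_irrefl _ (h2 z hz _ hyZ (h1 z hz))

theorem Finset.forall_le_or_exists_next (Z : Finset ℝ) (z : ℝ) :
    (∀ y ∈ Z, y ≤ z) ∨ ∃ y ∈ Z, z < y ∧ ∀ w ∈ Z, z < w → y ≤ w := by
  by_cases h : (Z.filter (z < ·)).Nonempty
  · obtain ⟨y, hy, hm⟩ := (Z.filter (z < ·)).exists_min_image id h
    rw [Finset.mem_filter] at hy
    exact Or.inr ⟨y, hy.1, hy.2, fun w hw hzw => hm w (Finset.mem_filter.2 ⟨hw, hzw⟩)⟩
  · refine Or.inl fun y hy => ?_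
    by_contra hlt
    exact h ⟨y, Finset.mem_filter.2 ⟨hy, not_le.1 hlt⟩⟩

theorem exists_zeros_deriv_of_tendsto {f : smoothFun} (hf : Tendsto f.1 atTop (𝓝 0)) (Z : Finset ℝ)
    (hZ : ∀ z ∈ Z, f.1 z = 0) :
    ∃ Z' : Finset ℝ, Z'.card = Z.card ∧ Disjoint Z' Z ∧
      ∀ z ∈ Z', (smoothDeriv f).1 z = 0 ∧ ∃ y ∈ Z, y < z := by
  have key : ∀ z ∈ Z, ∃ ξ, z < ξ ∧ (∀ y ∈ Z, z < y → ξ < y) ∧ (smoothDeriv f).1 ξ = 0 := by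
    intro z hz
    rcases Z.forall_le_or_exists_next z with h | ⟨y, hy, hzy, hm⟩
    · obtain ⟨ξ, h1, h2⟩ := exists_deriv_eq_zero_of_tendsto hf (hZ z hz)
      exact ⟨ξ, h1, fun y hy hzy => absurd (h y hy) (not_le.2 hzy), h2⟩
    · obtain ⟨ξ, h1, h2, h3⟩ := exists_expOp_eq_zero f 0 hzy (hZ z hz) (hZ y hy)
      rw [expOp_singleton_zero] at h3
      exact ⟨ξ, h1, fun w hw hzw => h2.trans_le (hm w hw hzw), h3⟩
  choose! ξ h1 h2 h3 using key
  obtain ⟨hc, hd⟩ := card_image_of_interlacing h1 h2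
  refine ⟨Z.image ξ, hc, hd, fun w hw => ?_⟩
  obtain ⟨z, hz, rfl⟩ := Finset.mem_image.1 hw
  exact ⟨h3 z hz, z, hz, h1 z hz⟩

theorem exists_zeros_expOp (f : smoothFun) (c : ℝ) (Z : Finset ℝ) (hZ : ∀ z ∈ Z, f.1 z = 0) :
    ∃ Z' : Finset ℝ, Z.card ≤ Z'.card + 1 ∧ ∀ z ∈ Z', (expOp {c} f).1 z = 0 := by
  rcases Z.eq_empty_or_nonempty with rfl | hne
  · exact ⟨∅, by simp⟩
  obtain ⟨m, hm, hmax⟩ := Z.exists_max_image id hne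
  have key : ∀ z ∈ Z.erase m,
      ∃ ξ, z < ξ ∧ (∀ y ∈ Z, z < y → ξ < y) ∧ (expOp {c} f).1 ξ = 0 := by
    intro z hz
    obtain ⟨hzm, hz⟩ := Finset.mem_erase.1 hz
    rcases Z.forall_le_or_exists_next z with h | ⟨y, hy, hzy, hmin⟩
    · exact absurd (le_antisymm (hmax z hz) (h m hm)) hzm
    · obtain ⟨ξ, h1, h2, h3⟩ := exists_expOp_eq_zero f c hzy (hZ z hz) (hZ y hy)
      exact ⟨ξ, h1, fun w hw hzw => h2.trans_le (hmin w hw hzw), h3⟩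
  choose! ξ h1 h2 h3 using key
  obtain ⟨hc, -⟩ := card_image_of_interlacing h1
    fun z hz y hy => h2 z hz y (Finset.mem_of_mem_erase hy)
  refine ⟨(Z.erase m).image ξ, ?_, fun w hw => ?_⟩
  · rw [hc, Finset.card_erase_of_mem hm]
    omega
  · obtain ⟨z, hz, rfl⟩ := Finset.mem_image.1 hw
    exact h3 z hz

/-- Each factor `D + c` costs at most one zero. By induction `(D + c) f = 0`, so `f` is a multiple
of `e^{-ct}` with a zero. -/
theorem eq_zero_of_card_le_zeros {s : Multiset ℝ} {f : smoothFun} (hf : f ∈ expSol s)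
    (Z : Finset ℝ) (hZ : ∀ z ∈ Z, f.1 z = 0) (hc : s.card ≤ Z.card) : f = 0 := by
  induction s using Multiset.induction_on generalizing f Z with
  | empty => simpa [expSol_zero] using hf
  | cons c s ih =>
    rw [Multiset.card_cons] at hc
    obtain ⟨Z', h1, h2⟩ := exists_zeros_expOp f c Z hZ
    have h3 := eq_smul_polyExp_one (ih (expOp_singleton_mem hf) Z' h2 (by omega))
    obtain ⟨z, hz⟩ : Z.Nonempty := Finset.card_pos.1 (by omega)
    have h4 := hZ z hz
    rw [h3] at h4
    have h5 : f.1 0 * (eval z 1 * Real.exp (-c * z)) = 0 := h4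
    have h6 : f.1 0 = 0 := by simpa using h5
    rw [h3, h6, zero_smul]

theorem eq_zero_of_smoothDeriv_eq_zero {f : smoothFun} (hf : Tendsto f.1 atTop (𝓝 0))
    (h : smoothDeriv f = 0) : f = 0 := by
  rw [← expOp_singleton_zero] at h
  have h1 := eq_smul_polyExp_one h
  have h2 : f.1 = fun _ => f.1 0 := by
    conv_lhs => rw [h1]
    funext t
    change f.1 0 * (eval t 1 * Real.exp (-0 * t)) = _
    simp
  have h3 : f.1 0 = 0 := by
    rw [h2] at hf
    exact tendsto_nhds_unique tendsto_const_nhds hf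
  rw [h1, h3, zero_smul]

/-- The condition at the origin counts as one more zero: differentiating `j` times keeps the number
of positive zeros, and then `0` itself is added. -/
theorem eq_zero_of_zeros_pos {s : Multiset ℝ} (hs : ∀ c ∈ s, 0 < c) {f : smoothFun}
    (hf : f ∈ expSol s) (j : ℕ) (h0 : ((smoothDeriv ^ j) f).1 0 = 0) (Z : Finset ℝ)
    (hZ : ∀ z ∈ Z, 0 < z ∧ f.1 z = 0) (hc : s.card ≤ Z.card + 1) : f = 0 := by
  induction j generalizing f Z with
  | zero =>
    have hn : (0 : ℝ) ∉ Z := fun h => lt_irrefl _ (hZ 0 h).1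
    refine eq_zero_of_card_le_zeros hf (insert 0 Z) (fun z hz => ?_) ?_
    · rcases Finset.mem_insert.1 hz with rfl | hz
      · simpa using h0
      · exact (hZ z hz).2
    · rwa [Finset.card_insert_of_notMem hn]
  | succ j ih =>
    have ht := tendsto_of_mem_expSol hs hf
    obtain ⟨Z', h1, -, h2⟩ := exists_zeros_deriv_of_tendsto ht Z fun z hz => (hZ z hz).2
    refine eq_zero_of_smoothDeriv_eq_zero ht (ih (smoothDeriv_mem_expSol hf) h0 Z' ?_ (by omega))
    intro z hz
    obtain ⟨h3, y, hy, hyz⟩ := h2 z hz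
    exact ⟨(hZ y hy).1.trans hyz, h3⟩

/-- One differentiation moves every zero strictly to the right, so a zero at the origin becomes
admissible once `k ≥ 1`. -/
theorem eq_zero_of_zeros_nonneg {s : Multiset ℝ} (hs : ∀ c ∈ s, 0 < c) {f : smoothFun}
    (hf : f ∈ expSol s) {k : ℕ} (hk : 1 ≤ k) (h0 : ((smoothDeriv ^ k) f).1 0 = 0) (Z : Finset ℝ)
    (hZ : ∀ z ∈ Z, 0 ≤ z ∧ f.1 z = 0) (hc : s.card ≤ Z.card + 1) : f = 0 := by
  obtain ⟨j, rfl⟩ := Nat.exists_eq_add_of_le' hk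
  have ht := tendsto_of_mem_expSol hs hf
  obtain ⟨Z', h1, -, h2⟩ := exists_zeros_deriv_of_tendsto ht Z fun z hz => (hZ z hz).2
  refine eq_zero_of_smoothDeriv_eq_zero ht
    (eq_zero_of_zeros_pos hs (smoothDeriv_mem_expSol hf) j h0 Z' ?_ (by omega))
  intro z hz
  obtain ⟨h3, y, hy, hyz⟩ := h2 z hz
  exact ⟨(hZ y hy).1.trans_lt hyz, h3⟩

/-- A double zero `z` would be a zero of the derivative beyond the Rolle zeros, which avoid `Z`;
that is one zero too many. -/
theorem smoothDeriv_ne_zero_of_zeros_pos {s : Multiset ℝ} (hs : ∀ c ∈ s, 0 < c) {f : smoothFun}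
    (hf : f ∈ expSol s) (hf0 : f ≠ 0) {k : ℕ} (hk : 1 ≤ k) (h0 : ((smoothDeriv ^ k) f).1 0 = 0)
    (Z : Finset ℝ) (hZ : ∀ z ∈ Z, 0 < z ∧ f.1 z = 0) (hc : s.card ≤ Z.card + 2) {z : ℝ}
    (hz : z ∈ Z) : (smoothDeriv f).1 z ≠ 0 := by
  intro hd
  obtain ⟨j, rfl⟩ := Nat.exists_eq_add_of_le' hk
  have ht := tendsto_of_mem_expSol hs hf
  obtain ⟨Z', h1, hdis, h2⟩ := exists_zeros_deriv_of_tendsto ht Z fun z hz => (hZ z hz).2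
  have hn : z ∉ Z' := fun h => Finset.disjoint_left.1 hdis h hz
  refine hf0 (eq_zero_of_smoothDeriv_eq_zero ht
    (eq_zero_of_zeros_pos hs (smoothDeriv_mem_expSol hf) j h0 (insert z Z') ?_
      (by rw [Finset.card_insert_of_notMem hn]; omega)))
  intro w hw
  rcases Finset.mem_insert.1 hw with rfl | hw
  · exact ⟨(hZ w hz).1, hd⟩
  · obtain ⟨h3, y, hy, hyz⟩ := h2 w hw
    exact ⟨(hZ y hy).1.trans hyz, h3⟩

/-! ### Sign patterns and alternation. -/

/-- A continuous function on the half-line whose zeros are the simple zeros in `Z` has the sign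
pattern of `∏ (t - z)`. -/
theorem sign_mul_prod_of_simple_zeros {f : ℝ → ℝ} (hf : Continuous f) (Z : Finset ℝ)
    (hZ : ∀ z ∈ Z, f z = 0 ∧ ∃ f', f' ≠ 0 ∧ HasDerivAt f f' z)
    (hne : ∀ t, 0 ≤ t → t ∉ Z → f t ≠ 0) {x y : ℝ} (hx : 0 ≤ x) (hy : 0 ≤ y) (hxZ : x ∉ Z)
    (hyZ : y ∉ Z) :
    0 < (f x * ∏ z ∈ Z, (x - z)) * (f y * ∏ z ∈ Z, (y - z)) := by
  induction Z using Finset.induction_on generalizing f with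
  | empty =>
    simp only [Finset.prod_empty, mul_one]
    by_contra hcon
    rw [not_lt, mul_nonpos_iff] at hcon
    have hsub : Set.uIcc x y ⊆ Set.Ici 0 := by
      intro t ht
      exact (le_min hx hy).trans ht.1
    have h0 : (0 : ℝ) ∈ Set.uIcc (f x) (f y) := by
      rw [Set.mem_uIcc]
      tauto
    obtain ⟨t, ht, he⟩ := intermediate_value_uIcc hf.continuousOn h0
    exact hne t (hsub ht) (Finset.notMem_empty t) he
  | insert a Z ha ih =>
    have hxa : x - a ≠ 0 := sub_ne_zero.2 fun h => hxZ (h ▸ Finset.mem_insert_self a Z)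
    have hya : y - a ≠ 0 := sub_ne_zero.2 fun h => hyZ (h ▸ Finset.mem_insert_self a Z)
    obtain ⟨hfa, f', hf', hda⟩ := hZ a (Finset.mem_insert_self a Z)
    have hds : ∀ t, t ≠ a → dslope f a t = f t / (t - a) := by
      intro t ht
      rw [dslope_of_ne _ ht, slope_def_field, hfa, sub_zero]
    have hcont : Continuous (dslope f a) := by
      rw [← continuousOn_univ, continuousOn_dslope univ_mem]
      exact ⟨hf.continuousOn, hda.differentiableAt⟩
    have hxZ' : x ∉ Z := fun h => hxZ (Finset.mem_insert_of_mem h)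
    have hyZ' : y ∉ Z := fun h => hyZ (Finset.mem_insert_of_mem h)
    have := ih hcont (fun z hz => ?_)
      (fun t ht htZ => ?_) hxZ' hyZ'
    · rw [Finset.prod_insert ha, Finset.prod_insert ha]
      rw [hds x (sub_ne_zero.1 hxa), hds y (sub_ne_zero.1 hya)] at this
      -- The zero `a` was divided out by `dslope`; multiplying by squares turns the quotients by `x
      -- - a` and `y - a` back into factors.
      have h2 := mul_pos this (mul_pos (pow_pos (abs_pos.2 hxa) 2) (pow_pos (abs_pos.2 hya) 2))
      rw [sq_abs, sq_abs] at h2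
      refine h2.trans_eq ?_
      field_simp
    · have hza : z ≠ a := fun h => ha (h ▸ hz)
      obtain ⟨hfz, g', hg', hdz⟩ := hZ z (Finset.mem_insert_of_mem hz)
      refine ⟨by rw [hds z hza, hfz, zero_div], g' / (z - a),
        div_ne_zero hg' (sub_ne_zero.2 hza), ?_⟩
      have h1 := hdz.div ((hasDerivAt_id z).sub_const a) (sub_ne_zero.2 hza)
      have h2 : dslope f a =ᶠ[𝓝 z] fun t => f t / (t - a) := by
        filter_upwards [isOpen_ne.mem_nhds hza] with t ht using hds t ht
      refine (h1.congr_deriv ?_).congr_of_eventuallyEq h2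
      have := sub_ne_zero.2 hza
      simp only [id, hfz]
      field_simp
      ring
    · by_cases hta : t = a
      · rw [hta, dslope_same, hda.deriv]
        exact hf'
      · rw [hds t hta]
        refine div_ne_zero (hne t ht ?_) (sub_ne_zero.2 hta)
        rw [Finset.mem_insert]
        tauto

/-- `f` takes values of alternating signs, the first one of the sign of `σ`, at `n` consecutive
points of `S`. -/
def Alternates (S : Set ℝ) (n : ℕ) (σ : ℝ) (f : ℝ → ℝ) : Prop :=
  ∃ t : ℕ → ℝ, (∀ i < n, t i ∈ S) ∧ (∀ i, i + 1 < n → t i < t (i + 1)) ∧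
    ∀ i < n, 0 < σ * (-1) ^ i * f (t i)

theorem Alternates.mono {S S' : Set ℝ} {n : ℕ} {σ : ℝ} {f : ℝ → ℝ} (h : Alternates S n σ f)
    (hS : S ⊆ S') : Alternates S' n σ f := by
  obtain ⟨t, h1, h2⟩ := h
  exact ⟨t, fun i hi => hS (h1 i hi), h2⟩

theorem Alternates.expOp_singleton {n : ℕ} {σ : ℝ} {f : smoothFun}
    (h : Alternates Set.univ (n + 1) σ f.1) (c : ℝ) :
    Alternates Set.univ n (-σ) (expOp {c} f).1 := by
  obtain ⟨t, -, hlt, hs⟩ := h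
  have key : ∀ i, i < n → ∃ ξ, t i < ξ ∧ ξ < t (i + 1) ∧
      0 < -σ * (-1) ^ i * (expOp {c} f).1 ξ := by
    intro i hi
    apply exists_pos_expOp_of_lt f c _ (hlt i (by omega))
    have h1 := mul_pos (Real.exp_pos (c * t i)) (hs i (by omega))
    have h2 := mul_pos (Real.exp_pos (c * t (i + 1))) (hs (i + 1) (by omega))
    rw [pow_succ] at h2
    linarith
  choose! ξ h1 h2 h3 using key
  exact ⟨ξ, fun _ _ => Set.mem_univ _, fun i hi => (h2 i (by omega)).trans (h1 (i + 1) hi), h3⟩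

theorem Alternates.expOp {s : Multiset ℝ} {σ : ℝ} {f : smoothFun}
    (h : Alternates Set.univ (s.card + 1) σ f.1) :
    ∃ x, 0 < σ * (-1) ^ s.card * (expOp s f).1 x := by
  induction s using Multiset.induction_on generalizing f σ with
  | empty =>
    obtain ⟨t, -, -, hs⟩ := h
    exact ⟨t 0, by simpa [expOp_zero_apply] using hs 0 (by simp)⟩
  | cons c s ih =>
    rw [Multiset.card_cons] at h
    obtain ⟨x, hx⟩ := ih (h.expOp_singleton c)
    refine ⟨x, ?_⟩
    rw [expOp_cons_apply', Multiset.card_cons, pow_succ]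
    linarith

/-- No alternation is lost: the last point is paired with infinity. All points become strictly
positive, and the sign flips. -/
theorem Alternates.smoothDeriv {n : ℕ} {σ : ℝ} {f : smoothFun}
    (h : Alternates (Set.Ici 0) n σ f.1) (hf : Tendsto f.1 atTop (𝓝 0)) :
    Alternates (Set.Ioi 0) n (-σ) (smoothDeriv f).1 := by
  obtain ⟨t, h0, hlt, hs⟩ := h
  have key : ∀ i, i < n → ∃ ξ, t i < ξ ∧ (i + 1 < n → ξ < t (i + 1)) ∧
      0 < -σ * (-1) ^ i * (_root_.smoothDeriv f).1 ξ := by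
    intro i hi
    by_cases hin : i + 1 < n
    · have h1 := hs i (by omega)
      have h2 := hs (i + 1) (by omega)
      obtain ⟨ξ, h3, h4, h5⟩ := exists_pos_expOp_of_lt f 0 (-σ * (-1) ^ i) (hlt i hin) (by
        rw [pow_succ] at h2
        simp only [zero_mul, Real.exp_zero, one_mul]
        linarith)
      rw [expOp_singleton_zero] at h5
      exact ⟨ξ, h3, fun _ => h4, h5⟩
    · obtain ⟨ξ, h1, h2⟩ := exists_neg_deriv_of_tendsto hf (σ * (-1) ^ i) (hs i hi)
      exact ⟨ξ, h1, fun h => absurd h hin, by linarith⟩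
  choose! ξ h1 h2 h3 using key
  exact ⟨ξ, fun i hi => (h0 i hi).trans_lt (h1 i hi),
    fun i hi => (h2 i (by omega) hi).trans (h1 (i + 1) hi), h3⟩

theorem Alternates.smoothDeriv_pow {s : Multiset ℝ} (hs : ∀ c ∈ s, 0 < c) {n : ℕ} {σ : ℝ}
    {f : smoothFun} (h : Alternates (Set.Ici 0) n σ f.1) (hf : f ∈ expSol s) {k : ℕ}
    (hk : 1 ≤ k) : Alternates (Set.Ioi 0) n (σ * (-1) ^ k) ((_root_.smoothDeriv ^ k) f).1 := by
  induction k, hk using Nat.le_induction generalizing f σ with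
  | base => simpa using h.smoothDeriv (tendsto_of_mem_expSol hs hf)
  | succ k hk ih =>
    have h1 := (h.smoothDeriv (tendsto_of_mem_expSol hs hf)).mono Set.Ioi_subset_Ici_self
    have h2 := ih h1 (smoothDeriv_mem_expSol hf)
    rwa [pow_succ', ← mul_assoc, mul_neg_one, pow_succ, Module.End.mul_apply]

/-- The zero at the origin supplies an extra interval before the first point, so the count is kept
and, with each new point to the left of the old one, so is the sign. -/
theorem Alternates.expOp_singleton_of_zero {n : ℕ} {σ : ℝ} {f : smoothFun}
    (h : Alternates (Set.Ioi 0) n σ f.1) (h0 : f.1 0 = 0) (c : ℝ) :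
    Alternates Set.univ n σ (_root_.expOp {c} f).1 := by
  obtain ⟨t, hpos, hlt, hs⟩ := h
  have key : ∀ i, i < n → ∃ ξ, ξ < t i ∧ (∀ j, i = j + 1 → t j < ξ) ∧
      0 < σ * (-1) ^ i * (_root_.expOp {c} f).1 ξ := by
    intro i hi
    have h1 := mul_pos (Real.exp_pos (c * t i)) (hs i hi)
    rcases i with - | i
    · obtain ⟨ξ, h2, h3, h4⟩ := exists_pos_expOp_of_lt f c (σ * (-1) ^ 0) (hpos 0 hi) (by
        rw [h0]
        linarith)
      exact ⟨ξ, h3, by simp, h4⟩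
    · have h2 := mul_pos (Real.exp_pos (c * t i)) (hs i (by omega))
      obtain ⟨ξ, h3, h4, h5⟩ := exists_pos_expOp_of_lt f c (σ * (-1) ^ (i + 1)) (hlt i hi) (by
        rw [pow_succ] at h1 ⊢
        linarith)
      refine ⟨ξ, h4, fun j hj => ?_, h5⟩
      obtain rfl : i = j := by omega
      exact h3
  choose! ξ h1 h2 h3 using key
  exact ⟨ξ, fun _ _ => Set.mem_univ _,
    fun i hi => (h1 i (by omega)).trans (h2 (i + 1) hi i rfl), h3⟩

/-! ### Extremal elements and duality. -/

/-- The convex hull of a compact set in a finite-dimensional space is compact. -/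
theorem IsCompact.isCompact_convexHull {E : Type*} [NormedAddCommGroup E] [NormedSpace ℝ E]
    [FiniteDimensional ℝ E] {S : Set E} (hS : IsCompact S) : IsCompact (convexHull ℝ S) := by
  rcases S.eq_empty_or_nonempty with rfl | ⟨x₀, hx₀⟩
  · simp
  set n := Module.finrank ℝ E + 1 with hn
  have hK : IsCompact (stdSimplex ℝ (Fin n) ×ˢ Set.univ.pi fun _ : Fin n => S) :=
    (isCompact_stdSimplex ℝ (Fin n)).prod (isCompact_univ_pi fun _ => hS)
  have hc : Continuous fun p : (Fin n → ℝ) × (Fin n → E) => ∑ i, p.1 i • p.2 i := by fun_prop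
  have heq : convexHull ℝ S = (fun p : (Fin n → ℝ) × (Fin n → E) => ∑ i, p.1 i • p.2 i) ''
      (stdSimplex ℝ (Fin n) ×ˢ Set.univ.pi fun _ : Fin n => S) := by
    ext x
    constructor
    · intro hx
      obtain ⟨ι, _, z, w, hz, hind, hw, hw1, rfl⟩ := eq_pos_convex_span_of_mem_convexHull hx
      have hcard : Fintype.card ι ≤ Fintype.card (Fin n) := by
        rw [Fintype.card_fin]
        exact hind.card_le_finrank_succ.trans
          (Nat.succ_le_succ (Submodule.finrank_le _))
      obtain ⟨e⟩ := Function.Embedding.nonempty_of_card_le hcard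
      refine ⟨(Function.extend e w 0, Function.extend e z fun _ => x₀), ⟨⟨fun i => ?_, ?_⟩, ?_⟩, ?_⟩
      · by_cases hi : ∃ j, e j = i
        · obtain ⟨j, rfl⟩ := hi
          simpa [e.injective.extend_apply] using (hw j).le
        · simp [Function.extend_apply' _ _ _ hi]
      · rw [← hw1]
        refine (Fintype.sum_of_injective e e.injective _ _ (fun i hi => ?_) fun i => ?_).symm
        · simp [Function.extend_apply' _ _ _ hi]
        · simp [e.injective.extend_apply]
      · intro i _
        by_cases hi : ∃ j, e j = i
        · obtain ⟨j, rfl⟩ := hi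
          simpa [e.injective.extend_apply] using hz ⟨j, rfl⟩
        · simpa [Function.extend_apply' _ _ _ hi] using hx₀
      · refine (Fintype.sum_of_injective e e.injective _ _ (fun i hi => ?_) fun i => ?_).symm
        · simp [Function.extend_apply' _ _ _ hi]
        · simp [e.injective.extend_apply]
    · rintro ⟨⟨w, z⟩, ⟨hw, hz⟩, rfl⟩
      exact (convex_convexHull ℝ S).sum_mem (fun i _ => hw.1 i) hw.2
        fun i _ => subset_convexHull ℝ S (hz i (Set.mem_univ i))
  rw [heq]
  exact hK.image hc

/-- Evaluation at a point, as a linear functional. -/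
def smoothEval (t : ℝ) : smoothFun →ₗ[ℝ] ℝ := LinearMap.proj t ∘ₗ smoothFun.subtype

/-- `T` maximizes the `k`-th derivative at the origin in the unit ball of `expSol s`. -/
def IsExtremal (k : ℕ) (s : Multiset ℝ) (T : smoothFun) : Prop :=
  T ∈ expSol s ∧ (∀ t, 0 ≤ t → |T.1 t| ≤ 1) ∧
    ∀ p ∈ expSol s, (∀ t, 0 ≤ t → |p.1 t| ≤ 1) →
      ((smoothDeriv ^ k) p).1 0 ≤ ((smoothDeriv ^ k) T).1 0

instance expSol_free (s : Multiset ℝ) : Module.Free ℝ (expSol s) :=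
  @Module.Free.of_divisionRing ℝ (expSol s) _ _ _

theorem apply_eq_sum_repr {s : Multiset ℝ} {n : ℕ} (b : Module.Basis (Fin n) ℝ (expSol s))
    (φ : smoothFun →ₗ[ℝ] ℝ) (r : expSol s) : φ r.1 = ∑ i, b.repr r i * φ (b i).1 := by
  have h := congrArg (φ ∘ₗ (expSol s).subtype) (b.sum_repr r)
  simp only [map_sum, map_smul, smul_eq_mul] at h
  exact h.symm

theorem exists_isExtremal (k : ℕ) (s : Multiset ℝ) : ∃ T, IsExtremal k s T := by
  let b := Module.finBasis ℝ (expSol s)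
  let E : (Fin (Module.finrank ℝ (expSol s)) → ℝ) →ₗ[ℝ] smoothFun :=
    (expSol s).subtype ∘ₗ b.equivFun.symm.toLinearMap
  have hE : ∀ c, E c ∈ expSol s := fun c => (b.equivFun.symm c).2
  have hE' : ∀ p ∈ expSol s, ∃ c, E c = p := fun p hp =>
    ⟨b.equivFun ⟨p, hp⟩, congrArg Subtype.val (b.equivFun.symm_apply_apply ⟨p, hp⟩)⟩
  have hEinj : ∀ c, E c = 0 → c = 0 := by
    intro c hc
    have : b.equivFun.symm c = 0 := Subtype.ext hc
    exact b.equivFun.symm.map_eq_zero_iff.1 this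
  have hcont : ∀ φ : smoothFun →ₗ[ℝ] ℝ, Continuous fun c => φ (E c) := fun φ =>
    (φ ∘ₗ E).continuous_of_finiteDimensional
  let B : Set (Fin (Module.finrank ℝ (expSol s)) → ℝ) := {c | ∀ t, 0 ≤ t → |(E c).1 t| ≤ 1}
  have hclosed : IsClosed B := by
    have : B = ⋂ t, ⋂ (_ : (0 : ℝ) ≤ t), {c | |(E c).1 t| ≤ 1} := by
      ext c
      simp [B]
    rw [this]
    exact isClosed_iInter fun t => isClosed_iInter fun _ =>
      isClosed_le (hcont (smoothEval t)).abs continuous_const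
  have hbdd : Bornology.IsBounded B := by
    -- Evaluation at `0, 1, …, card s - 1` is injective by zero counting, hence bounds the
    -- coefficients on the unit ball.
    let e : (Fin (Module.finrank ℝ (expSol s)) → ℝ) →ₗ[ℝ] (Fin s.card → ℝ) :=
      LinearMap.pi fun j => smoothEval (j : ℕ) ∘ₗ E
    have he : LinearMap.ker e = ⊥ := by
      rw [LinearMap.ker_eq_bot']
      intro c hc
      have hinj : Function.Injective fun j : Fin s.card => ((j : ℕ) : ℝ) :=
        Nat.cast_injective.comp Fin.val_injective
      refine hEinj c (eq_zero_of_card_le_zeros (hE c)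
        (Finset.univ.image fun j : Fin s.card => ((j : ℕ) : ℝ)) (fun z hz => ?_) ?_)
      · obtain ⟨j, -, rfl⟩ := Finset.mem_image.1 hz
        exact congrFun hc j
      · rw [Finset.card_image_of_injective _ hinj, Finset.card_univ, Fintype.card_fin]
    obtain ⟨K, -, hK⟩ := e.exists_antilipschitzWith he
    refine (hK.isBounded_preimage (Metric.isBounded_closedBall (x := 0) (r := 1))).subset ?_
    intro c hc
    rw [Set.mem_preimage, mem_closedBall_zero_iff, pi_norm_le_iff_of_nonneg zero_le_one]
    exact fun j => hc _ (Nat.cast_nonneg _)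
  have h0 : (0 : Fin (Module.finrank ℝ (expSol s)) → ℝ) ∈ B := by
    intro t _
    rw [map_zero]
    simp
  obtain ⟨c, hc, hmax⟩ := (Metric.isCompact_of_isClosed_isBounded hclosed hbdd).exists_isMaxOn ⟨0, h0⟩
    (hcont (smoothEval 0 ∘ₗ (smoothDeriv ^ k))).continuousOn
  refine ⟨E c, hE c, hc, fun p hp hp1 => ?_⟩
  obtain ⟨c', rfl⟩ := hE' p hp
  exact hmax hp1

theorem IsExtremal.pos {k : ℕ} {s : Multiset ℝ} {T : smoothFun} (hT : IsExtremal k s T)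
    (hs : ∀ c ∈ s, 0 < c) (hne : s ≠ 0) : 0 < ((smoothDeriv ^ k) T).1 0 := by
  obtain ⟨c, hc⟩ := Multiset.exists_mem_of_ne_zero hne
  have hc0 := hs c hc
  -- The competitor `(-1)ᵏ e^{-ct}` has `k`-th derivative `cᵏ > 0` at the origin.
  have hmem : (-1 : ℝ) ^ k • polyExp c 1 ∈ expSol s := by
    apply Submodule.smul_mem
    apply expSol_mono (Multiset.singleton_le.2 hc)
    simpa using polyExp_X_pow_mem c 0
  have h1 := hT.2.2 _ hmem fun t ht => by
    change |(-1 : ℝ) ^ k * (eval t 1 * Real.exp (-c * t))| ≤ 1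
    rw [abs_mul, abs_pow, abs_neg, abs_one, one_pow, one_mul, eval_one, one_mul, Real.abs_exp,
      Real.exp_le_one_iff]
    nlinarith
  rw [map_smul, smoothDeriv_pow_polyExp_one, smul_smul, ← mul_pow] at h1
  refine lt_of_lt_of_le ?_ h1
  change 0 < (-1 * -c) ^ k * (eval 0 1 * Real.exp (-c * 0))
  simp only [neg_mul_neg, one_mul, eval_one, mul_zero, Real.exp_zero, mul_one]
  positivity

/-- Translating `p` by `t ≥ 0` stays in the unit ball and moves the value at `t` to the origin;
applying this to `-p` too gives the absolute value. -/
theorem IsExtremal.abs_deriv_le {k : ℕ} {s : Multiset ℝ} {T : smoothFun} (hT : IsExtremal k s T)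
    {p : smoothFun} (hp : p ∈ expSol s) (hp1 : ∀ t, 0 ≤ t → |p.1 t| ≤ 1) {t : ℝ} (ht : 0 ≤ t) :
    |((smoothDeriv ^ k) p).1 t| ≤ ((smoothDeriv ^ k) T).1 0 := by
  have key : ∀ q ∈ expSol s, (∀ t, 0 ≤ t → |q.1 t| ≤ 1) →
      ((smoothDeriv ^ k) q).1 t ≤ ((smoothDeriv ^ k) T).1 0 := by
    intro q hq hq1
    have := hT.2.2 _ (smoothShift_mem_expSol hq t) fun x hx => hq1 (x + t) (by linarith)
    rw [smoothDeriv_pow_shift] at this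
    refine le_of_eq_of_le ?_ this
    change _ = ((smoothDeriv ^ k) q).1 (0 + t)
    rw [zero_add]
  rw [abs_le']
  refine ⟨key p hp hp1, ?_⟩
  have := key (-p) (Submodule.neg_mem _ hp) fun x hx => by
    change |-(p.1 x)| ≤ 1
    rw [abs_neg]
    exact hp1 x hx
  rwa [map_neg] at this

/-- Dual characterization of extremal elements. -/
theorem IsExtremal.exists_finset {k : ℕ} {s : Multiset ℝ} {T : smoothFun} (hT : IsExtremal k s T)
    (hs : ∀ c ∈ s, 0 < c) (hne : s ≠ 0) :
    ∃ F : Finset ℝ, (∀ t ∈ F, 0 ≤ t ∧ |T.1 t| = 1) ∧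
      ∀ r ∈ expSol s, (∀ t ∈ F, 0 < T.1 t * r.1 t) → 0 < ((smoothDeriv ^ k) r).1 0 := by
  have hM := hT.pos hs hne
  set M := ((smoothDeriv ^ k) T).1 0 with hMdef
  let b := Module.finBasis ℝ (expSol s)
  set n := Module.finrank ℝ (expSol s)
  let ℓ : smoothFun →ₗ[ℝ] ℝ := smoothEval 0 ∘ₗ (smoothDeriv ^ k)
  let v : ℝ → Fin n → ℝ := fun t i => (b i).1.1 t
  let w : Fin n → ℝ := fun i => ℓ (b i).1
  have hv : Continuous fun t => v |t| :=
    continuous_pi fun i => (continuous_smoothFun _).comp continuous_abs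
  have hv0 : Tendsto (fun t => v |t|) (cocompact ℝ) (𝓝 0) := by
    refine tendsto_pi_nhds.2 fun i => ?_
    exact (tendsto_of_mem_expSol hs (b i).2).comp tendsto_norm_cocompact_atTop
  -- Signed evaluations scaled by `M`, in coordinates. Inserting `0`, the evaluation at infinity,
  -- makes the set compact.
  let S : Set (Fin n → ℝ) := (fun p : ℝ × (Fin n → ℝ) => (M * p.1) • p.2) ''
    (Set.Icc (-1) 1 ×ˢ insert 0 (Set.range fun t => v |t|))
  have hS : IsCompact S :=
    (isCompact_Icc.prod (hv0.isCompact_insert_range_of_cocompact hv)).image (by fun_prop)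
  have hSmem : ∀ z ∈ S, ∃ ε t : ℝ, |ε| ≤ 1 ∧ 0 ≤ t ∧ z = (M * ε) • v t := by
    rintro z ⟨⟨ε, x⟩, ⟨hε, hx⟩, rfl⟩
    rcases hx with rfl | ⟨t, rfl⟩
    · exact ⟨0, 0, by simp, le_rfl, by simp⟩
    · exact ⟨ε, |t|, abs_le.2 hε, abs_nonneg t, rfl⟩
  have hmemS : ∀ ε t : ℝ, |ε| ≤ 1 → 0 ≤ t → (M * ε) • v t ∈ S := fun ε t hε ht =>
    ⟨(ε, v t), ⟨abs_le.1 hε, Or.inr ⟨t, by simp only [abs_of_nonneg ht]⟩⟩, rfl⟩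
  have hw : w ∈ convexHull ℝ S := by
    -- A separating functional is an element `r` with `M |r| < u` on the half-line and `r⁽ᵏ⁾(0) >
    -- u`; then `(M / u) r` beats `T`.
    by_contra hcon
    obtain ⟨g, u, h1, h2⟩ := geometric_hahn_banach_closed_point (convex_convexHull ℝ S)
      hS.isCompact_convexHull.isClosed hcon
    let r : expSol s := ∑ i, g (Pi.single i 1) • b i
    have hr : ∀ φ : smoothFun →ₗ[ℝ] ℝ, φ r.1 = g fun i => φ (b i).1 := by
      intro φ
      have h3 := LinearMap.pi_apply_eq_sum_univ g.toLinearMap fun i => φ (b i).1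
      simp only [ContinuousLinearMap.coe_coe] at h3
      rw [h3]
      simp only [r, AddSubmonoidClass.coe_finsetSum, map_sum, SetLike.val_smul, map_smul, smul_eq_mul]
      refine Finset.sum_congr rfl fun i _ => ?_
      rw [mul_comm]
      congr 2
      ext j
      simp [Pi.single_apply, eq_comm]
    have hrt : ∀ t, r.1.1 t = g (v t) := fun t => hr (smoothEval t)
    have hu : ∀ ε t : ℝ, |ε| ≤ 1 → 0 ≤ t → M * ε * r.1.1 t < u := by
      intro ε t hε ht
      have := h1 _ (subset_convexHull ℝ S (hmemS ε t hε ht))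
      rwa [map_smul, smul_eq_mul, ← hrt] at this
    have hu0 : 0 < u := by simpa using hu 0 0 (by simp) le_rfl
    have hb := hT.2.2 ((M / u) • r.1) (Submodule.smul_mem _ _ r.2) fun t ht => by
      change |M / u * r.1.1 t| ≤ 1
      rw [div_mul_eq_mul_div, abs_div, abs_of_pos hu0, div_le_one hu0, abs_le']
      have h3 := hu 1 t (by simp) ht
      have h4 := hu (-1) t (by simp) ht
      constructor <;> linarith
    rw [map_smul] at hb
    have h5 : M / u * ℓ r.1 ≤ M := hb
    rw [hr ℓ, div_mul_eq_mul_div, div_le_iff₀ hu0] at h5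
    exact absurd h5 (not_le.2 (mul_lt_mul_of_pos_left h2 hM))
  obtain ⟨ι, _, c, z, hc0, hc1, hzS, hzw⟩ := mem_convexHull_iff_exists_fintype.1 hw
  choose ε τ hε hτ hz using fun i => hSmem (z i) (hzS i)
  have hrep : ∀ r ∈ expSol s, ℓ r = ∑ i, c i * (M * ε i * r.1 (τ i)) := by
    intro r hr
    have h1 := apply_eq_sum_repr b ℓ ⟨r, hr⟩
    have h2 : ∀ t, r.1 t = ∑ j, b.repr ⟨r, hr⟩ j * v t j := fun t =>
      apply_eq_sum_repr b (smoothEval t) ⟨r, hr⟩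
    have h3 : ∀ j, ℓ (b j).1 = ∑ i, c i * (M * ε i * v (τ i) j) := by
      intro j
      have := congrFun hzw j
      simp only [hz, Finset.sum_apply, Pi.smul_apply, smul_eq_mul] at this
      exact this.symm
    change ℓ r = _ at h1
    rw [h1]
    simp only [h2, h3, Finset.mul_sum]
    rw [Finset.sum_comm]
    refine Finset.sum_congr rfl fun i _ => Finset.sum_congr rfl fun j _ => ?_
    ring
  have hle : ∀ i, ε i * T.1 (τ i) ≤ 1 := by
    intro i
    refine (le_abs_self _).trans ?_
    rw [abs_mul]
    exact mul_le_one₀ (hε i) (abs_nonneg _) (hT.2.1 _ (hτ i))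
  -- Applied to `T`, the representation is an equality case: every node of positive weight must be a
  -- contact point with `ε i` the sign of `T`.
  have hsum : ∑ i, c i * (1 - ε i * T.1 (τ i)) = 0 := by
    have h1 : M = ∑ i, c i * (M * ε i * T.1 (τ i)) := hrep T hT.1
    have h2 : M * ∑ i, c i * (1 - ε i * T.1 (τ i)) = M * ∑ i, c i -
        ∑ i, c i * (M * ε i * T.1 (τ i)) := by
      rw [Finset.mul_sum, Finset.mul_sum, ← Finset.sum_sub_distrib]
      refine Finset.sum_congr rfl fun i _ => ?_
      ring
    rw [← h1, hc1, mul_one, sub_self] at h2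
    exact (mul_eq_zero.1 h2).resolve_left hM.ne'
  have heq : ∀ i, 0 < c i → |T.1 (τ i)| = 1 ∧ ε i = T.1 (τ i) := by
    intro i hi
    have h1 := (Finset.sum_eq_zero_iff_of_nonneg fun i _ =>
      mul_nonneg (hc0 i) (sub_nonneg.2 (hle i))).1 hsum i (Finset.mem_univ i)
    have h2 := (mul_eq_zero.1 h1).resolve_left hi.ne'
    have h3 := abs_le.1 (hε i)
    have h4 := abs_le.1 (hT.2.1 _ (hτ i))
    have h5 : ε i = T.1 (τ i) := by nlinarith
    refine ⟨?_, h5⟩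
    rw [h5] at h2
    have h6 : T.1 (τ i) * T.1 (τ i) = 1 := by linarith
    rcases mul_self_eq_one_iff.1 h6 with h | h <;> simp [h]
  refine ⟨(Finset.univ.filter fun i => 0 < c i).image τ, fun t ht => ?_, fun r hr hpos => ?_⟩
  · obtain ⟨i, hi, rfl⟩ := Finset.mem_image.1 ht
    exact ⟨hτ i, (heq i (Finset.mem_filter.1 hi).2).1⟩
  · have h1 : ℓ r = _ := hrep r hr
    change 0 < ℓ r
    have hterm : ∀ i, 0 < c i → 0 < c i * (M * ε i * r.1 (τ i)) := by
      intro i hi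
      have h2 := hpos (τ i) (Finset.mem_image_of_mem τ (Finset.mem_filter.2 ⟨Finset.mem_univ i, hi⟩))
      rw [(heq i hi).2, mul_assoc]
      positivity
    rw [h1]
    obtain ⟨i, -, hi⟩ := Finset.exists_ne_zero_of_sum_ne_zero
      (show ∑ i, c i ≠ 0 by rw [hc1]; exact one_ne_zero)
    have hi' := lt_of_le_of_ne (hc0 i) (Ne.symm hi)
    refine Finset.sum_pos' (fun j _ => ?_) ⟨i, Finset.mem_univ i, hterm i hi'⟩
    rcases (hc0 j).eq_or_lt with h | h
    · rw [← h, zero_mul]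
    · exact (hterm j h).le

/-! ### Equioscillation of extremal elements. -/

/-- The sign pattern of a nowhere vanishing function on a finite set: a maximal alternating
sequence, and points separating the blocks of constant sign. -/
theorem exists_alternation_and_separation (T : ℝ → ℝ) (F : Finset ℝ) (hF : F.Nonempty)
    (hT : ∀ t ∈ F, T t ≠ 0) :
    ∃ (σ : ℝ) (Z : Finset ℝ), Alternates F (Z.card + 1) σ T ∧
      (∀ z ∈ Z, z ∉ F ∧ ∃ y ∈ F, y < z) ∧
      ∀ t ∈ F, 0 < σ * (-1) ^ Z.card * T t * ∏ z ∈ Z, (t - z) := by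
  suffices h : ∃ (σ : ℝ) (Z : Finset ℝ), Alternates F (Z.card + 1) σ T ∧
      (∀ z ∈ Z, z ∉ F ∧ ∃ y ∈ F, y < z) ∧
      (∀ t ∈ F, 0 < σ * (-1) ^ Z.card * T t * ∏ z ∈ Z, (t - z)) ∧
      ∃ y ∈ F, (∀ t ∈ F, t ≤ y) ∧ (∀ z ∈ Z, z < y) ∧ 0 < σ * (-1) ^ Z.card * T y by
    obtain ⟨σ, Z, h1, h2, h3, -⟩ := h
    exact ⟨σ, Z, h1, h2, h3⟩
  induction F using Finset.induction_on_max with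
  | empty => exact absurd hF Finset.not_nonempty_empty
  | insert x F hx ih =>
    have hTx := hT x (Finset.mem_insert_self x F)
    rcases F.eq_empty_or_nonempty with rfl | hne
    · refine ⟨T x, ∅, ⟨fun _ => x, by simp, by simp, fun i hi => ?_⟩, by simp, ?_, x,
        by simp, by simp, by simp, ?_⟩
      · obtain rfl : i = 0 := by simpa using hi
        simpa using hTx
      · simpa using hTx
      · simpa using hTx
    obtain ⟨σ, Z, ⟨τ, hτF, hτ, hτs⟩, hZ, hs, y, hyF, hFy, hyZ, hy⟩ :=
      ih hne fun t ht => hT t (Finset.mem_insert_of_mem ht)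
    have hyx := hx y hyF
    have hprod : ∀ Z' : Finset ℝ, (∀ z ∈ Z', z < x) → 0 < ∏ z ∈ Z', (x - z) := fun Z' h =>
      Finset.prod_pos fun z hz => sub_pos.2 (h z hz)
    have hZx : ∀ z ∈ Z, z < x := fun z hz => (hyZ z hz).trans hyx
    have hZx' : ∀ z ∈ Z, z ∉ insert x F ∧ ∃ y ∈ insert x F, y < z := by
      intro z hz
      obtain ⟨h1, w, hw, hwz⟩ := hZ z hz
      refine ⟨fun h => ?_, w, Finset.mem_insert_of_mem hw, hwz⟩
      rcases Finset.mem_insert.1 h with rfl | h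
      · exact lt_irrefl _ (hZx z hz)
      · exact h1 h
    have hxF : ∀ t ∈ insert x F, t ≤ x := by
      intro t ht
      rcases Finset.mem_insert.1 ht with rfl | ht
      · exact le_rfl
      · exact (hx t ht).le
    have hσ : σ * (-1) ^ Z.card ≠ 0 := fun h => by simp [h] at hy
    rcases lt_or_gt_of_ne (mul_ne_zero hσ hTx) with hneg | hpos
    -- The sign changes between the old maximum `y` and the new point `x`, so a separator is placed
    -- at their midpoint.
    · set m := (x + y) / 2 with hm
      have hym : y < m := by linarith
      have hmx : m < x := by linarith
      have hmZ : m ∉ Z := fun h => lt_irrefl _ ((hyZ m h).trans hym)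
      have hmx' : ∀ z ∈ insert m Z, z < x := by
        intro z hz
        rcases Finset.mem_insert.1 hz with rfl | hz
        · exact hmx
        · exact hZx z hz
      have hc : (insert m Z).card = Z.card + 1 := Finset.card_insert_of_notMem hmZ
      have hpos : 0 < σ * (-1) ^ (Z.card + 1) * T x := by
        rw [pow_succ]
        linarith
      refine ⟨σ, insert m Z, ⟨fun i => if i ≤ Z.card then τ i else x, ?_, ?_, ?_⟩, ?_, ?_, x,
        Finset.mem_insert_self x F, hxF, hmx', by rwa [hc]⟩
      · intro i _
        simp only [Finset.coe_insert]
        split_ifs with h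
        · exact Or.inr (hτF i (by omega))
        · exact Or.inl rfl
      · intro i hi
        rw [hc] at hi
        simp only [show i ≤ Z.card by omega, if_true]
        split_ifs with h
        · exact hτ i (by omega)
        · exact hx _ (hτF i (by omega))
      · intro i hi
        rw [hc] at hi
        simp only
        split_ifs with h
        · exact hτs i (by omega)
        · obtain rfl : i = Z.card + 1 := by omega
          exact hpos
      · intro z hz
        rcases Finset.mem_insert.1 hz with rfl | hz
        · refine ⟨fun h => ?_, y, Finset.mem_insert_of_mem hyF, hym⟩
          rcases Finset.mem_insert.1 h with h | h
          · exact hmx.ne h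
          · exact not_le.2 hym (hFy m h)
        · exact hZx' z hz
      · intro t ht
        rw [hc]
        rcases Finset.mem_insert.1 ht with rfl | ht
        · exact mul_pos hpos (hprod _ hmx')
        · rw [Finset.prod_insert hmZ, pow_succ]
          have h1 := mul_pos (hs t ht) (sub_pos.2 ((hFy t ht).trans_lt hym))
          refine h1.trans_eq ?_
          ring
    · refine ⟨σ, Z, ⟨τ, fun i hi => Finset.mem_insert_of_mem (hτF i hi), hτ, hτs⟩, hZx', ?_, x,
        Finset.mem_insert_self x F, hxF, hZx, hpos⟩
      intro t ht
      rcases Finset.mem_insert.1 ht with rfl | ht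
      · exact mul_pos hpos (hprod Z hZx)
      · exact hs t ht

/-- Too few sign changes would allow an `r` with the signs of `T` on the dual set `F` and `r⁽ᵏ⁾(0) =
0`, against duality. -/
theorem IsExtremal.alternates {k : ℕ} (hk : 1 ≤ k) {s : Multiset ℝ} (hs : ∀ c ∈ s, 0 < c)
    (hne : s ≠ 0) {T : smoothFun} (hT : IsExtremal k s T) :
    ∃ σ, Alternates {t | 0 ≤ t ∧ |T.1 t| = 1} s.card σ T.1 := by
  obtain ⟨F, hF, hdual⟩ := hT.exists_finset hs hne
  have hFne : F.Nonempty := by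
    rw [Finset.nonempty_iff_ne_empty]
    rintro rfl
    have := hdual 0 (Submodule.zero_mem _) (by simp)
    rw [map_zero] at this
    exact lt_irrefl _ this
  have hT0 : ∀ t ∈ F, T.1 t ≠ 0 := fun t ht h => by simpa [h] using (hF t ht).2
  obtain ⟨σ, Z, ⟨τ, h1, h2, h3⟩, hZ, hsign⟩ := exists_alternation_and_separation T.1 F hFne hT0
  by_cases hcard : s.card ≤ Z.card + 1
  · exact ⟨σ, τ, fun i hi => hF _ (h1 i (by omega)), fun i hi => h2 i (by omega),
      fun i hi => h3 i (by omega)⟩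
  exfalso
  -- Exactly `Z.card + 2` exponents: enough for a nonzero `r` satisfying `Z.card + 1` linear
  -- conditions, and few enough that zero counting leaves no zeros outside `Z` and makes those in
  -- `Z` simple.
  obtain ⟨u, hus, hu⟩ : ∃ u ≤ s, u.card = Z.card + 2 := by
    refine ⟨(s.toList.take (Z.card + 2) : List ℝ), ?_, ?_⟩
    · conv_rhs => rw [← s.coe_toList]
      exact (List.take_sublist _ _).subperm
    · rw [Multiset.coe_card, List.length_take, Multiset.length_toList]
      omega
  have hu0 : ∀ c ∈ u, 0 < c := fun c hc => hs c (Multiset.mem_of_le hus hc)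
  let Λ : expSol u →ₗ[ℝ] (Z → ℝ) × ℝ :=
    ((LinearMap.pi fun z : Z => smoothEval z).prod (smoothEval 0 ∘ₗ (smoothDeriv ^ k))) ∘ₗ
      (expSol u).subtype
  have hker : LinearMap.ker Λ ≠ ⊥ := by
    apply LinearMap.ker_ne_bot_of_finrank_lt (V := expSol u) (V₂ := (Z → ℝ) × ℝ) (f := Λ)
    have := card_le_finrank_expSol u
    rw [Module.finrank_prod, Module.finrank_fintype_fun_eq_card, Fintype.card_coe,
      Module.finrank_self]
    omega
  obtain ⟨⟨r, hr⟩, hrΛ, hr0⟩ := Submodule.exists_mem_ne_zero_of_ne_bot hker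
  have hr0' : r ≠ 0 := fun h => hr0 (Subtype.ext h)
  have hrΛ' := Prod.ext_iff.1 (LinearMap.mem_ker.1 hrΛ)
  have hrZ : ∀ z ∈ Z, r.1 z = 0 := fun z hz => congrFun hrΛ'.1 ⟨z, hz⟩
  have hrk : ((smoothDeriv ^ k) r).1 0 = 0 := hrΛ'.2
  have hZpos : ∀ z ∈ Z, 0 < z := by
    intro z hz
    obtain ⟨-, y, hy, hyz⟩ := hZ z hz
    exact (hF y hy).1.trans_lt hyz
  have hzero : ∀ t, 0 ≤ t → t ∉ Z → r.1 t ≠ 0 := by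
    intro t ht htZ h
    refine hr0' (eq_zero_of_zeros_nonneg hu0 hr hk hrk (insert t Z) (fun z hz => ?_) ?_)
    · rcases Finset.mem_insert.1 hz with rfl | hz
      · exact ⟨ht, h⟩
      · exact ⟨(hZpos z hz).le, hrZ z hz⟩
    · rw [Finset.card_insert_of_notMem htZ]
      omega
  have hFZ : ∀ t ∈ F, t ∉ Z := fun t ht htZ => (hZ t htZ).1 ht
  obtain ⟨x, hx⟩ := hFne
  -- The sign of `B` records how `r` compares with `∏ (t - z)`; it is the same at every point of
  -- `F`.
  set B := r.1 x * ∏ z ∈ Z, (x - z)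
  have hpos : ∀ t ∈ F, 0 < T.1 t * ((σ * (-1) ^ Z.card * B) • r).1 t := by
    intro t ht
    have h4 := sign_mul_prod_of_simple_zeros (continuous_smoothFun r) Z
      (fun z hz => ⟨hrZ z hz, _, smoothDeriv_ne_zero_of_zeros_pos hu0 hr hr0' hk hrk Z
        (fun z hz => ⟨hZpos z hz, hrZ z hz⟩) hu.le hz, hasDerivAt_smoothFun r z⟩)
      hzero (hF x hx).1 (hF t ht).1 (hFZ x hx) (hFZ t ht)
    have h5 := mul_pos (hsign t ht) h4
    change 0 < T.1 t * (σ * (-1) ^ Z.card * B * r.1 t)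
    have h6 : 0 < (T.1 t * (σ * (-1) ^ Z.card * B * r.1 t)) * (∏ z ∈ Z, (t - z)) ^ 2 := by
      refine h5.trans_eq ?_
      ring
    exact pos_of_mul_pos_left h6 (sq_nonneg _)
  have := hdual _ (Submodule.smul_mem _ _ (expSol_mono hus hr)) hpos
  rw [map_smul] at this
  change 0 < σ * (-1) ^ Z.card * B * ((smoothDeriv ^ k) r).1 0 at this
  rw [hrk, mul_zero] at this
  exact lt_irrefl _ this

/-! ### Comparison of extremal values under a change of exponents. -/

theorem lt_of_lt_of_forall_lt_succ {t : ℕ → ℝ} {n : ℕ} (h : ∀ i, i + 1 < n → t i < t (i + 1))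
    {i j : ℕ} (hij : i < j) (hj : j < n) : t i < t j := by
  induction j, hij using Nat.le_induction with
  | base => exact h i hj
  | succ j _ ih => exact (ih (by omega)).trans (h j hj)

/-- Interpolation at `card s - 1` nodes with a prescribed derivative at the origin equal to zero. -/
theorem exists_interpolation {k : ℕ} (hk : 1 ≤ k) {s : Multiset ℝ} (hs : ∀ c ∈ s, 0 < c) {d : ℕ}
    (hd : s.card = d + 1) {t : ℕ → ℝ} (ht0 : ∀ i < d, 0 ≤ t i)
    (ht : ∀ i, i + 1 < d → t i < t (i + 1)) (y : ℕ → ℝ) :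
    ∃ r ∈ expSol s, ((smoothDeriv ^ k) r).1 0 = 0 ∧ ∀ i < d, r.1 (t i) = y i := by
  let Λ : expSol s →ₗ[ℝ] (Fin d → ℝ) × ℝ :=
    ((LinearMap.pi fun i : Fin d => smoothEval (t i)).prod
      (smoothEval 0 ∘ₗ (smoothDeriv ^ k))) ∘ₗ (expSol s).subtype
  have htinj : Function.Injective fun i : Fin d => t i := by
    intro i j hij
    rcases lt_trichotomy i j with h | h | h
    · exact absurd hij (lt_of_lt_of_forall_lt_succ ht h j.2).ne
    · exact h
    · exact absurd hij (lt_of_lt_of_forall_lt_succ ht h i.2).ne'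
  have hinj : Function.Injective Λ := by
    refine LinearMap.ker_eq_bot (M := expSol s) (f := Λ) |>.1 ?_
    refine (Submodule.eq_bot_iff _).2 ?_
    rintro ⟨r, hr⟩ hrΛ
    have hrΛ' := Prod.ext_iff.1 (LinearMap.mem_ker.1 hrΛ)
    refine Subtype.ext (eq_zero_of_zeros_nonneg hs hr hk hrΛ'.2
      (Finset.univ.image fun i : Fin d => t i) (fun z hz => ?_) ?_)
    · obtain ⟨i, -, rfl⟩ := Finset.mem_image.1 hz
      exact ⟨ht0 i i.2, congrFun hrΛ'.1 i⟩
    · rw [Finset.card_image_of_injective _ htinj, Finset.card_univ, Fintype.card_fin, hd]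
  have hfin : Module.finrank ℝ ((Fin d → ℝ) × ℝ) = d + 1 := by simp
  have hsurj : Function.Surjective Λ := by
    refine (LinearMap.injective_iff_surjective_of_finrank_eq_finrank (V := expSol s)
      (V₂ := (Fin d → ℝ) × ℝ) (f := Λ) ?_).1 hinj
    apply le_antisymm (LinearMap.finrank_le_finrank_of_injective hinj)
    rw [hfin, ← hd]
    exact card_le_finrank_expSol s
  obtain ⟨⟨r, hr⟩, hrΛ⟩ := hsurj (fun i => y i, 0)
  have hrΛ' := Prod.ext_iff.1 hrΛ
  exact ⟨r, hr, hrΛ'.2, fun i hi => congrFun hrΛ'.1 ⟨i, hi⟩⟩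

theorem polyExp_one_pos (a t : ℝ) : 0 < (polyExp a 1).1 t := by
  rw [polyExp_coe, eval_one, one_mul]
  exact Real.exp_pos _

theorem smul_polyExp_one_apply (K a t : ℝ) :
    (K • polyExp a 1).1 t = K * (polyExp a 1).1 t := rfl

/-- If `T` equioscillates, no element of the unit ball for a system with one exponent lowered has the
same `k`-th derivative at the origin. -/
theorem deriv_ne_of_exponent_lt {k : ℕ} (hk : 1 ≤ k) {s : Multiset ℝ} {a b : ℝ} (hab : a < b)
    (hs : ∀ c ∈ a ::ₘ b ::ₘ s, 0 < c) {T p : smoothFun} (hT : T ∈ expSol (b ::ₘ s)) {σ : ℝ}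
    (halt : Alternates {t | 0 ≤ t ∧ |T.1 t| = 1} (s.card + 1) σ T.1)
    (hp : p ∈ expSol (a ::ₘ s)) (hp1 : ∀ t, 0 ≤ t → |p.1 t| ≤ 1) :
    ((smoothDeriv ^ k) p).1 0 ≠ ((smoothDeriv ^ k) T).1 0 := by
  intro heq
  obtain ⟨x, hx⟩ := (halt.mono (Set.subset_univ _)).expOp
  obtain ⟨t, htS, htlt, hts⟩ := halt
  have hb : 0 < b := hs b (by simp)
  have hσ : σ ≠ 0 := fun h => by simpa [h] using hts 0 (by omega)
  -- The difference `T - p` has only weak signs at the nodes; adding `η r` makes them strict without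
  -- changing the `k`-th derivative at the origin.
  obtain ⟨r, hr, hrk, hrt⟩ := exists_interpolation hk hs (d := s.card + 1) (by simp)
    (fun i hi => (htS i hi).1) htlt fun i => σ * (-1) ^ i
  have hTmem : T ∈ expSol (a ::ₘ b ::ₘ s) := expSol_mono (Multiset.le_cons_self _ _) hT
  have hpmem : p ∈ expSol (a ::ₘ b ::ₘ s) := by
    rw [Multiset.cons_swap]
    exact expSol_mono (Multiset.le_cons_self _ _) hp
  obtain ⟨C, hC⟩ : ∃ C : ℝ, expOp s T = C • polyExp b 1 :=
    ⟨_, eq_smul_polyExp_one (by rw [← expOp_cons_apply]; exact hT)⟩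
  obtain ⟨K, hK⟩ : ∃ K : ℝ, expOp (a ::ₘ s) r = K • polyExp b 1 :=
    ⟨_, eq_smul_polyExp_one (by
      rw [← expOp_cons_apply, Multiset.cons_swap]
      exact hr)⟩
  have hCa : expOp (a ::ₘ s) T = (C * (a - b)) • polyExp b 1 := by
    rw [expOp_cons_apply, hC, map_smul, expOp_singleton_polyExp, derivative_one, zero_add, mul_one,
      polyExp_C, smul_smul]
  have hG : 0 < σ * (-1) ^ s.card * C := by
    rw [hC, smul_polyExp_one_apply, ← mul_assoc] at hx
    exact pos_of_mul_pos_left hx (polyExp_one_pos b x).le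
  -- Sign of the coefficient of `e^{-bt}` left after applying all factors except `D + b` to the
  -- perturbed difference; `p` contributes nothing.
  have key : ∀ η : ℝ, 0 < η → 0 < σ * (-1) ^ s.card * (C * (a - b) + η * K) := by
    intro η hη
    set f : smoothFun := T - p + η • r with hf
    have hfmem : f ∈ expSol (a ::ₘ b ::ₘ s) :=
      Submodule.add_mem _ (Submodule.sub_mem _ hTmem hpmem) (Submodule.smul_mem _ _ hr)
    have hft : ∀ t, f.1 t = T.1 t - p.1 t + η * r.1 t := fun t => rfl
    have hfalt : Alternates (Set.Ici 0) (s.card + 1) σ f.1 := by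
      refine ⟨t, fun i hi => (htS i hi).1, htlt, fun i hi => ?_⟩
      rw [hft, hrt i hi]
      set κ := σ * (-1) ^ i with hκ
      have hκ0 : κ ≠ 0 := mul_ne_zero hσ (pow_ne_zero _ (by norm_num))
      have h1 : T.1 (t i) * T.1 (t i) = 1 := by
        rw [← abs_mul_abs_self, (htS i hi).2, one_mul]
      have h2 : T.1 (t i) * p.1 (t i) ≤ 1 := by
        refine (le_abs_self _).trans ?_
        rw [abs_mul, (htS i hi).2, one_mul]
        exact hp1 _ (htS i hi).1
      have h3 := mul_nonneg (hts i hi).le (sub_nonneg.2 h2)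
      have h4 : κ * T.1 (t i) * (1 - T.1 (t i) * p.1 (t i)) = κ * (T.1 (t i) - p.1 (t i)) := by
        linear_combination (-κ * p.1 (t i)) * h1
      rw [h4] at h3
      have h5 : 0 < η * (κ * κ) := mul_pos hη (mul_self_pos.2 hκ0)
      linarith
    have hfk : ((smoothDeriv ^ k) f).1 0 = 0 := by
      have : ((smoothDeriv ^ k) f).1 0 = ((smoothDeriv ^ k) T).1 0 - ((smoothDeriv ^ k) p).1 0 +
          η * ((smoothDeriv ^ k) r).1 0 := by
        rw [hf, map_add, map_sub, map_smul]
        rfl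
      rw [this, heq, hrk]
      ring
    obtain ⟨y, hy⟩ := ((hfalt.smoothDeriv_pow hs hfmem hk).expOp_singleton_of_zero hfk a).expOp
    have hop : expOp (a ::ₘ s) f = (C * (a - b) + η * K) • polyExp b 1 := by
      rw [hf, map_add, map_sub, map_smul, hCa, hK, mem_expSol.1 hp, sub_zero, smul_smul, ← add_smul]
    rw [← expOp_cons_apply', expOp_smoothDeriv_pow, hop, map_smul, smoothDeriv_pow_polyExp_one,
      smul_smul, smul_polyExp_one_apply] at hy
    have h6 : 0 < (σ * (-1) ^ s.card * (C * (a - b) + η * K)) * (b ^ k * (polyExp b 1).1 y) := by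
      refine hy.trans_eq ?_
      have h7 : (-1 : ℝ) ^ k * (-b) ^ k = b ^ k := by rw [← mul_pow]; simp
      linear_combination (σ * (-1) ^ s.card * (C * (a - b) + η * K) * (polyExp b 1).1 y) * h7
    exact pos_of_mul_pos_left h6 (mul_pos (pow_pos hb k) (polyExp_one_pos b y)).le
  set G := σ * (-1) ^ s.card * C
  set L := σ * (-1) ^ s.card * K
  have hδ : 0 < G * (b - a) := mul_pos hG (sub_pos.2 hab)
  have hL : 0 < |L| + 1 := by positivity
  -- This `η` is small enough that `η * L < G * (b - a)`, so the term with `a - b` dominates and is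
  -- negative.
  have h8 := key (G * (b - a) / (|L| + 1)) (div_pos hδ hL)
  have h9 : σ * (-1) ^ s.card * (C * (a - b) + G * (b - a) / (|L| + 1) * K) =
      G * (b - a) * (L - (|L| + 1)) / (|L| + 1) := by
    field_simp
    ring
  rw [h9, div_pos_iff_of_pos_right hL] at h8
  have h10 := le_abs_self L
  exact absurd (pos_of_mul_pos_right h8 hδ.le) (by linarith)

theorem IsExtremal.lt_of_exponent_lt {k : ℕ} (hk : 1 ≤ k) {s : Multiset ℝ} {a b : ℝ} (hab : a < b)
    (hs : ∀ c ∈ a ::ₘ b ::ₘ s, 0 < c) {p T : smoothFun} (hp : IsExtremal k (a ::ₘ s) p)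
    (hT : IsExtremal k (b ::ₘ s) T) :
    ((smoothDeriv ^ k) p).1 0 < ((smoothDeriv ^ k) T).1 0 := by
  have hbs : ∀ c ∈ b ::ₘ s, 0 < c := fun c hc => hs c (Multiset.mem_cons_of_mem hc)
  obtain ⟨σ, halt⟩ := hT.alternates hk hbs (Multiset.cons_ne_zero)
  rw [Multiset.card_cons] at halt
  have hM := hT.pos hbs (Multiset.cons_ne_zero)
  by_contra hcon
  rw [not_lt] at hcon
  have hp0 := hM.trans_le hcon
  -- If the lowered system did at least as well, shrinking `p` would match the derivatives exactly
  -- while staying in the unit ball.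
  set lam := ((smoothDeriv ^ k) T).1 0 / ((smoothDeriv ^ k) p).1 0 with hlam
  have hlam1 : |lam| ≤ 1 := by
    rw [abs_of_pos (div_pos hM hp0)]
    exact (div_le_one hp0).2 hcon
  refine deriv_ne_of_exponent_lt hk hab hs hT.1 halt (p := lam • p)
    (Submodule.smul_mem _ _ hp.1) (fun t ht => ?_) ?_
  · change |lam * p.1 t| ≤ 1
    rw [abs_mul]
    exact mul_le_one₀ hlam1 (abs_nonneg _) (hp.2.1 t ht)
  · rw [map_smul]
    exact div_mul_cancel₀ _ hp0.ne'

/-- The exponents of `s` are raised to `1` one at a time, with `u` holding those kept fixed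
meanwhile. Any exponent below `1` makes its step strict, which gives the equality case. -/
theorem IsExtremal.le_replicate_one {k : ℕ} (hk : 1 ≤ k) (s u : Multiset ℝ)
    (hs : ∀ c ∈ s, 0 < c ∧ c ≤ 1) (hu : ∀ c ∈ u, 0 < c) {p T : smoothFun}
    (hp : IsExtremal k (s + u) p) (hT : IsExtremal k (Multiset.replicate s.card 1 + u) T) :
    ((smoothDeriv ^ k) p).1 0 ≤ ((smoothDeriv ^ k) T).1 0 ∧
      (((smoothDeriv ^ k) T).1 0 ≤ ((smoothDeriv ^ k) p).1 0 → ∀ c ∈ s, c = 1) := by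
  induction s using Multiset.induction_on generalizing u p T with
  | empty =>
    rw [Multiset.card_zero, Multiset.replicate_zero] at hT
    exact ⟨hT.2.2 p hp.1 hp.2.1, by simp⟩
  | cons a s ih =>
    obtain ⟨ha0, ha1⟩ := hs a (Multiset.mem_cons_self a s)
    have hs' := fun c hc => hs c (Multiset.mem_cons_of_mem hc)
    set w := Multiset.replicate s.card (1 : ℝ) + u with hw
    have hw0 : ∀ c ∈ w, 0 < c := by
      intro c hc
      rcases Multiset.mem_add.1 hc with hc | hc
      · rw [Multiset.eq_of_mem_replicate hc]
        exact one_pos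
      · exact hu c hc
    rw [Multiset.card_cons, Multiset.replicate_succ, Multiset.cons_add, ← hw] at hT
    have hua : ∀ c ∈ a ::ₘ u, 0 < c := by
      intro c hc
      rcases Multiset.mem_cons.1 hc with rfl | hc
      · exact ha0
      · exact hu c hc
    have hpa : IsExtremal k (s + a ::ₘ u) p := by
      rwa [Multiset.add_cons, ← Multiset.cons_add]
    obtain ⟨q, hq⟩ := exists_isExtremal k (Multiset.replicate s.card 1 + a ::ₘ u)
    obtain ⟨h1, h2⟩ := ih (a ::ₘ u) hs' hua hpa hq
    rw [Multiset.add_cons, ← hw] at hq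
    rcases ha1.eq_or_lt with rfl | hlt
    · have h3 := hT.2.2 q hq.1 hq.2.1
      refine ⟨h1.trans h3, fun h4 c hc => ?_⟩
      rcases Multiset.mem_cons.1 hc with rfl | hc
      · rfl
      · exact h2 (h3.trans h4) c hc
    · have h3 : ((smoothDeriv ^ k) q).1 0 < ((smoothDeriv ^ k) T).1 0 := by
        refine hq.lt_of_exponent_lt hk hlt (fun c hc => ?_) hT
        rcases Multiset.mem_cons.1 hc with rfl | hc
        · exact ha0
        rcases Multiset.mem_cons.1 hc with rfl | hc
        · exact one_pos
        · exact hw0 c hc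
      exact ⟨h1.trans h3.le, fun h4 => absurd (h1.trans_lt h3) (not_lt.2 h4)⟩

/-! ### Extended-real norms and the final statement. -/

theorem halfLineNorm_le_ofReal {f : ℝ → ℝ} {M : ℝ} (hM : 0 ≤ M) :
    halfLineNorm f ≤ ENNReal.ofReal M ↔ ∀ t, 0 ≤ t → |f t| ≤ M := by
  unfold halfLineNorm
  rw [iSup₂_le_iff]
  refine forall₂_congr fun t _ => ?_
  rw [Real.enorm_eq_ofReal_abs, ENNReal.ofReal_le_ofReal_iff hM]

theorem halfLineNorm_le_one {f : ℝ → ℝ} :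
    halfLineNorm f ≤ 1 ↔ ∀ t, 0 ≤ t → |f t| ≤ 1 := by
  rw [← ENNReal.ofReal_one, halfLineNorm_le_ofReal zero_le_one]

theorem IsExtremal.isGreatest {d k : ℕ} {h : Fin d → ℝ} {T : smoothFun}
    (hT : IsExtremal k (Finset.univ.val.map h) T) :
    IsGreatest (derivNormValues k h) (ENNReal.ofReal (((smoothDeriv ^ k) T).1 0)) := by
  have hM : 0 ≤ ((smoothDeriv ^ k) T).1 0 :=
    (abs_nonneg _).trans (hT.abs_deriv_le hT.1 hT.2.1 le_rfl)
  constructor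
  · refine ⟨T.1, ?_, halfLineNorm_le_one.2 hT.2.1, le_antisymm ?_ ?_⟩
    · rw [expPoly_eq_map]
      exact Submodule.mem_map_of_mem hT.1
    · rw [halfLineNorm_le_ofReal hM, ← smoothDeriv_pow_coe]
      exact fun t ht => hT.abs_deriv_le hT.1 hT.2.1 ht
    · rw [← smoothDeriv_pow_coe]
      refine le_trans ?_ (le_iSup₂ (f := fun t (_ : t ∈ Set.Ici (0 : ℝ)) =>
        ‖((smoothDeriv ^ k) T).1 t‖ₑ) 0 Set.self_mem_Ici)
      rw [Real.enorm_eq_ofReal_abs, abs_of_nonneg hM]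
  · rintro _ ⟨p, hp, hp1, rfl⟩
    rw [expPoly_eq_map] at hp
    obtain ⟨f, hf, rfl⟩ := hp
    change halfLineNorm (iteratedDeriv k f.1) ≤ _
    rw [halfLineNorm_le_ofReal hM, ← smoothDeriv_pow_coe]
    exact fun t ht => hT.abs_deriv_le hf (halfLineNorm_le_one.1 hp1) ht

theorem IsExtremal.markovConst_eq {d k : ℕ} {h : Fin d → ℝ} {T : smoothFun}
    (hT : IsExtremal k (Finset.univ.val.map h) T) :
    markovConst k h = ENNReal.ofReal (((smoothDeriv ^ k) T).1 0) :=
  hT.isGreatest.isLUB.sSup_eq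

theorem theorem1 (d k : ℕ) (hd : 1 ≤ d) (hk : 1 ≤ k) :
    -- the constants are finite, and are genuine maxima
    (∀ h ∈ expSimplex d,
      markovConst k h < ⊤ ∧ IsGreatest (derivNormValues k h) (markovConst k h)) ∧
    -- the maximum over the simplex is attained at the vector of ones
    (fun _ => 1 : Fin d → ℝ) ∈ expSimplex d ∧
    IsMaxOn (markovConst k) (expSimplex d) (fun _ => 1 : Fin d → ℝ) ∧
    -- and at no other point
    (∀ h ∈ expSimplex d, IsMaxOn (markovConst k) (expSimplex d) h → h = fun _ => 1) := by
  have hone : (fun _ => 1 : Fin d → ℝ) ∈ expSimplex d :=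
    ⟨monotone_const, fun _ => ⟨one_pos, le_rfl⟩⟩
  obtain ⟨T, hT⟩ := exists_isExtremal k (Finset.univ.val.map (fun _ => 1 : Fin d → ℝ))
  have hcomp : ∀ h ∈ expSimplex d, ∀ p, IsExtremal k (Finset.univ.val.map h) p →
      ((smoothDeriv ^ k) p).1 0 ≤ ((smoothDeriv ^ k) T).1 0 ∧
        (((smoothDeriv ^ k) T).1 0 ≤ ((smoothDeriv ^ k) p).1 0 →
          ∀ c ∈ Finset.univ.val.map h, c = 1) := by
    intro h hh p hp
    refine IsExtremal.le_replicate_one hk _ 0 (fun c hc => ?_) (by simp) (by rwa [add_zero]) ?_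
    · obtain ⟨i, -, rfl⟩ := Multiset.mem_map.1 hc
      exact hh.2 i
    · rw [Multiset.map_const'] at hT
      rwa [add_zero, Multiset.card_map]
  refine ⟨fun h _ => ?_, hone, fun h hh => ?_, fun h hh hmax => ?_⟩
  · obtain ⟨p, hp⟩ := exists_isExtremal k (Finset.univ.val.map h)
    rw [hp.markovConst_eq]
    exact ⟨ENNReal.ofReal_lt_top, hp.isGreatest⟩
  · obtain ⟨p, hp⟩ := exists_isExtremal k (Finset.univ.val.map h)
    change markovConst k h ≤ markovConst k fun _ => 1
    rw [hp.markovConst_eq, hT.markovConst_eq]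
    exact ENNReal.ofReal_le_ofReal (hcomp h hh p hp).1
  · obtain ⟨p, hp⟩ := exists_isExtremal k (Finset.univ.val.map h)
    have hle : markovConst k (fun _ => 1) ≤ markovConst k h := hmax hone
    have hne : Finset.univ.val.map h ≠ 0 := by
      rw [← Multiset.card_pos, Multiset.card_map, Finset.card_val, Finset.card_univ,
        Fintype.card_fin]
      exact hd
    have hpos : 0 < ((smoothDeriv ^ k) p).1 0 := by
      refine hp.pos (fun c hc => ?_) hne
      obtain ⟨i, -, rfl⟩ := Multiset.mem_map.1 hc
      exact (hh.2 i).1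
    rw [hp.markovConst_eq, hT.markovConst_eq, ENNReal.ofReal_le_ofReal_iff hpos.le] at hle
    funext i
    exact (hcomp h hh p hp).2 hle _ (Multiset.mem_map_of_mem h (Finset.mem_univ_val i))
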